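/- **Setting.** Let $V$ be a finite non-empty set, $n=|V|$, $p\in(0,1]$, $q\in[0,1)$. An *edge-Markovian graph* is a random sequence $G_0,G_1,\dots$ of simple graphs on $V$ with $G_0$ arbitrary such that, given the past, each pair of distinct vertices is independently an edge of $G_{t+1}$ with probability $1-q$ if it is an edge of $G_t$, and with probability $p$ otherwise. A *random matching algorithm* on it, started from a configuration $\Gamma_0\in\mathbb N^V$, does the following at each time $t=0,1,2,\dots$: it draws a random matching $M_t\subseteq E(G_t)$ from a distribution $\mathcal D_t$ that may depend on $G_t$ and on the history $\mathcal E_t=\big((\Gamma_s,G_s,M_s)_{s<t},\Gamma_t\big)$; then, independently for every $\{v,u\}\in M_t$, it sets $(\Gamma_{t+1}(v),\Gamma_{t+1}(u))$ to $\big(\lceil\frac{\Gamma_t(v)+\Gamma_t(u)}2\rceil,\lfloor\frac{\Gamma_t(v)+\Gamma_t(u)}2\rfloor\big)$ or to $\big(\lfloor\frac{\Gamma_t(v)+\Gamma_t(u)}2\rfloor,\lceil\frac{\Gamma_t(v)+\Gamma_t(u)}2\rceil\big)$ with probability $1/2$ each, and leaves the load of unmatched vertices unchanged. Given the past, this step and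 the step from $G_t$ to $G_{t+1}$ are independent. The algorithm is *$F$-fair* if, for all $t$, every graph $G$ on $V$, every edge $\{v,u\}$ of $G$ and every history, $$\Pr\big[\{v,u\}\in M_t \,\big|\, G_t=G,\ \mathcal E_t\big]\ \ge\ \frac{F}{\max\{\deg_G(v),\deg_G(u)\}} .$$ Let $\mu=\frac1n\sum_{v}\Gamma_0(v)$, $\lceil x\rfloor=\lceil x-\frac12\rceil$, $\Delta=\max_v\Gamma_0(v)-\min_v\Gamma_0(v)$, $r=\frac{\max\{p,1-q\}}{\min\{p,1-q\}}$, and $$T_{\mathrm{bal}}=\min\{t\ge 0:\ \Gamma_t(v)\in\{\lceil\mu\rfloor-1,\lceil\mu\rfloor,\lceil\mu\rfloor+1\}\text{ for all }v\in V\}$$ (with $T_{\mathrm{bal}}=\infty$ if there is no such $t$). **Theorem.** 1. For all constants $\theta,F,a>0$ there is a constant $C=C(\theta,F,a)>0$ such that for every finite non-empty $V$ with $n=|V|$, all $p\in(0,1]$ and $q\in[0,1)$ with $\max\{p,1-q\}\ge\theta/n$, every $F$-fair random matching algorithm, every initial graph $G_0$ and every initial configuration $\Gamma_0$, $$\Pr\big[\,T_{\mathrm{bal}}\le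 C\, r\log(\Delta n)\,\big]\ \ge\ 1-n^{-a},$$ where for $\Delta=0$ the right-hand side $C\,r\log(\Delta n)$ is read as $0$. That is, $T_{\mathrm{bal}}=O(r\log(\Delta n))$ with high probability. 2. The LR algorithm is a $\frac18$-fair random matching algorithm. Here, given $G$, each ordered pair $(v,u)$ of adjacent vertices is put in a set $\vec M$ independently with probability $\frac1{8\max\{\deg v,\deg u\}}$; then all pairs $(v,u)\in\vec M$ with tail $v$ of out-degree greater than $1$ are deleted; then all remaining pairs $(u,v)$ with head $v$ of in-degree greater than $1$ (among the remaining pairs) are deleted; the output is the set of all $\{v,u\}$ such that $(v,u)$ remains and either no remaining pair has head $v$, or $(u,v)$ remains too. 3. The localized distributed synchronous algorithm is a $\frac14$-fair random matching algorithm. Here, given $G$, each vertex is put in a set $I$ independently with probability $\frac12$; each $v\in I$ with at least one neighbour chooses, independently, a uniformly random neighbour $u$ and puts $(v,u)$ in $\vec M$ with probability $\frac{\min\{\deg u,\deg v\}}{\deg u}$; the output is the set of all $\{v,u\}$ with $(v,u)\in\vec M$, $u\notin I$ and exactly one pair of $\vec M$ with head $u$. In particular, the bound in part 1 holds for these two algorithms.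 -/

import Mathlib

section LoadBalancing

open MeasureTheory ProbabilityTheory
open scoped Classical ENNReal

/-! ### Elementary random choices -/

/-- A coin that shows `true` with probability `x` (for `0 ≤ x ≤ 1`). -/
noncomputable def coin (x : ℝ) : PMF Bool :=
  PMF.ofFintype (fun b => cond b (min (ENNReal.ofReal x) 1) (1 - min (ENNReal.ofReal x) 1)) (by
    simp [add_tsub_cancel_of_le (min_le_right (ENNReal.ofReal x) 1)])

/-- The law of a family of independent random variables, the `i`-th one with law `f i`. -/
noncomputable def independentFamily {ι α : Type*} [Fintype ι] [Fintype α] (f : ι → PMF α) :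
    PMF (ι → α) :=
  PMF.ofFintype (fun x => ∏ i, f i (x i)) (by
    rw [← Fintype.prod_sum]
    refine Finset.prod_eq_one fun i _ => ?_
    rw [← tsum_fintype (L := .unconditional _), (f i).tsum_coe])

/-! ### Edge-Markovian graphs -/

/-- The law of `G_{t+1}` given `G_t = G`: independently for every pair of distinct vertices,
an edge of `G` stays with probability `1 - q`, a non-edge becomes an edge with probability `p`.
(`SimpleGraph.fromEdgeSet` ignores the diagonal of `Sym2 V`.) -/
noncomputable def edgeMarkovStep {V : Type*} [Fintype V] (p q : ℝ) (G : SimpleGraph V) :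
    PMF (SimpleGraph V) :=
  (independentFamily fun e : Sym2 V => coin (if e ∈ G.edgeSet then 1 - q else p)).map
    fun x => SimpleGraph.fromEdgeSet {e | x e = true}

/-! ### Matchings and the balancing step -/

/-- `M` is a set of edges of `G`, no two of which share an end vertex. -/
def IsMatchingOf {V : Type*} (G : SimpleGraph V) (M : Set (Sym2 V)) : Prop :=
  M ⊆ G.edgeSet ∧ ∀ e ∈ M, ∀ f ∈ M, e ≠ f → ∀ v, ¬ (v ∈ e ∧ v ∈ f)

/-- The configuration after balancing along `M`, where `w e` is the end vertex of `e` that gets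
the larger half of the tokens on the two ends of `e`, and the other one gets the smaller half. -/
noncomputable def balanceAlong {V : Type*} (Γ : V → ℕ) (M : Set (Sym2 V)) (w : Sym2 V → V) :
    V → ℕ := fun v =>
  if h : ∃ u, s(v, u) ∈ M then
    if w s(v, h.choose) = v then (Γ v + Γ h.choose + 1) / 2 else (Γ v + Γ h.choose) / 2
  else Γ v

/-- The law of `Γ_{t+1}` given `Γ_t = Γ` and `M_t = M`: the end vertex of an edge that gets the
larger half is uniform, independently for different edges. -/
noncomputable def balanceStep {V : Type*} [Fintype V] (Γ : V → ℕ) (M : Set (Sym2 V)) :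
    PMF (V → ℕ) :=
  (independentFamily fun e : Sym2 V =>
      PMF.uniformOfFinset e.toFinset ⟨e.out.1, by simp [Sym2.out_fst_mem]⟩).map
    fun w => balanceAlong Γ M w

/-! ### Random matching algorithms and their executions -/

/-- The triple `(Γ_t, G_t, M_t)`. -/
structure Round (V : Type*) where
  config : V → ℕ
  graph : SimpleGraph V
  matching : Set (Sym2 V)

instance {V : Type*} : MeasurableSpace (Round V) := ⊤

/-- A rule that gives the law `𝒟_t` of `M_t`, which may depend on the time `t`, on the past
`(Γ_0, G_0, M_0), …, (Γ_{t-1}, G_{t-1}, M_{t-1})`, on `Γ_t` and on `G_t`. -/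
def MatchingRule (V : Type*) : Type _ :=
  (t : ℕ) → (Fin t → Round V) → (V → ℕ) → SimpleGraph V → PMF (Set (Sym2 V))

/-- The random set of edges is always a matching of the current graph. -/
def MatchingRule.IsRandomMatching {V : Type*} (A : MatchingRule V) : Prop :=
  ∀ (t : ℕ) (past : Fin t → Round V) (Γ : V → ℕ) (G : SimpleGraph V),
    ∀ M ∈ (A t past Γ G).support, IsMatchingOf G M

/-- The `F`-fair condition: whatever the history, each edge `{v, u}` of the current graph is
chosen with probability at least `F / max {deg v, deg u}`. -/
def MatchingRule.IsFair {V : Type*} [Fintype V] (A : MatchingRule V) (F : ℝ) : Prop :=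
  ∀ (t : ℕ) (past : Fin t → Round V) (Γ : V → ℕ) (G : SimpleGraph V) (v u : V), G.Adj v u →
    F / (max (G.degree v) (G.degree u) : ℕ)
      ≤ ((A t past Γ G).toOuterMeasure {M | s(v, u) ∈ M}).toReal

/-- The rule that draws `M_t` from a law depending only on `G_t`. -/
def MatchingRule.ofStatic {V : Type*} (D : SimpleGraph V → PMF (Set (Sym2 V))) : MatchingRule V :=
  fun _ _ _ G => D G

/-- The law of the first triple `(Γ_0, G_0, M_0)`. -/
noncomputable def firstRound {V : Type*} (A : MatchingRule V) (G₀ : SimpleGraph V) (Γ₀ : V → ℕ) :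
    PMF (Round V) :=
  (A 0 Fin.elim0 Γ₀ G₀).map fun M => ⟨Γ₀, G₀, M⟩

/-- The law of `(Γ_{t+1}, G_{t+1}, M_{t+1})` given the triples `h 0, …, h t`. -/
noncomputable def nextRound {V : Type*} [Fintype V] (A : MatchingRule V) (p q : ℝ) (t : ℕ)
    (h : Fin (t + 1) → Round V) : PMF (Round V) :=
  (balanceStep (h (Fin.last t)).config (h (Fin.last t)).matching).bind fun Γ =>
    (edgeMarkovStep p q (h (Fin.last t)).graph).bind fun G =>
      (A (t + 1) h Γ G).map fun M => ⟨Γ, G, M⟩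

instance {V : Type*} [Fintype V] : Countable (Round V) :=
  Function.Injective.countable
    (f := fun x : Round V => (x.config, x.graph, x.matching)) (by
      rintro ⟨a, b, c⟩ ⟨a', b', c'⟩ h
      simp only [Prod.mk.injEq] at h
      obtain ⟨rfl, rfl, rfl⟩ := h
      rfl)

/-- `nextRound` as a kernel from the first `t + 1` triples to the next one. -/
noncomputable def roundKernel {V : Type*} [Fintype V] (A : MatchingRule V) (p q : ℝ) (t : ℕ) :
    Kernel ((i : Finset.Iic t) → (fun _ : ℕ => Round V) i) (Round V) where
  toFun h := (nextRound A p q t fun i =>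
    h ⟨i, Finset.mem_Iic.2 (Nat.lt_succ_iff.1 i.isLt)⟩).toMeasure
  measurable' := measurable_of_countable _

instance {V : Type*} [Fintype V] (A : MatchingRule V) (p q : ℝ) (t : ℕ) :
    IsMarkovKernel (roundKernel A p q t) :=
  ⟨fun _ => PMF.toMeasure.isProbabilityMeasure _⟩

/-- The law of the execution `(Γ_0, G_0, M_0), (Γ_1, G_1, M_1), …` of the random matching
algorithm `A` on the edge-Markovian graph with parameters `p`, `q` and initial graph `G₀`,
from the initial configuration `Γ₀`. -/
noncomputable def executionLaw {V : Type*} [Fintype V] (A : MatchingRule V) (p q : ℝ)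
    (G₀ : SimpleGraph V) (Γ₀ : V → ℕ) : Measure (ℕ → Round V) :=
  Kernel.trajMeasure (X := fun _ : ℕ => Round V) (firstRound A G₀ Γ₀).toMeasure
    (roundKernel A p q)

/-! ### Balancing time -/

/-- The average number `μ` of tokens per vertex. -/
noncomputable def averageLoad {V : Type*} [Fintype V] (Γ : V → ℕ) : ℝ :=
  (∑ v, (Γ v : ℝ)) / Fintype.card V

/-- Rounding to the nearest integer, with ties rounded down. -/
noncomputable def nearestInt (x : ℝ) : ℤ := ⌈x - 1 / 2⌉

/-- `max Γ - min Γ`. -/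
noncomputable def discrepancy {V : Type*} [Fintype V] [Nonempty V] (Γ : V → ℕ) : ℕ :=
  Finset.univ.sup' Finset.univ_nonempty Γ - Finset.univ.inf' Finset.univ_nonempty Γ

/-- All loads of `Γ` are in `{m - 1, m, m + 1}`. -/
def IsBalancedAround {V : Type*} (m : ℤ) (Γ : V → ℕ) : Prop :=
  ∀ v, (Γ v : ℤ) = m - 1 ∨ (Γ v : ℤ) = m ∨ (Γ v : ℤ) = m + 1

/-- The first time at which all loads are within one of the rounded average load
(`⊤` if there is no such time). -/
noncomputable def balancingTime {V : Type*} [Fintype V] (ω : ℕ → Round V) : ℕ∞ :=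
  sInf {T : ℕ∞ | ∃ t : ℕ, T = t ∧
    IsBalancedAround (nearestInt (averageLoad (ω 0).config)) (ω t).config}

/-! ### The local randomized (LR) matching -/

/-- Number of out-neighbours of `v` in a set of directed edges. -/
noncomputable def outDeg {V : Type*} (E : Set (V × V)) (v : V) : ℕ := {u | (v, u) ∈ E}.ncard

/-- Number of in-neighbours of `v` in a set of directed edges. -/
noncomputable def inDeg {V : Type*} (E : Set (V × V)) (v : V) : ℕ := {u | (u, v) ∈ E}.ncard

/-- Delete all out-edges of vertices of out-degree more than one. -/
def pruneOut {V : Type*} (E : Set (V × V)) : Set (V × V) := {e ∈ E | ¬ 1 < outDeg E e.1}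

/-- Delete all in-edges of vertices of in-degree more than one. -/
def pruneIn {V : Type*} (E : Set (V × V)) : Set (V × V) := {e ∈ E | ¬ 1 < inDeg E e.2}

/-- The undirected edges kept from the pruned set `E` of directed edges. -/
def lrOutput {V : Type*} (E : Set (V × V)) : Set (Sym2 V) :=
  {e | ∃ v u, e = s(v, u) ∧ (v, u) ∈ E ∧ inDeg E v = 0} ∪
    {e | ∃ v u, e = s(v, u) ∧ (v, u) ∈ E ∧ (u, v) ∈ E}

/-- The LR matching of `G`: each ordered pair `(v, u)` of adjacent vertices is put in a set of
directed edges with probability `1 / (8 max {deg v, deg u})`, independently; then this set is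
pruned, first at its tails and then at its heads, and the output is read off. -/
noncomputable def lrMatching {V : Type*} [Fintype V] (G : SimpleGraph V) : PMF (Set (Sym2 V)) :=
  (independentFamily fun e : V × V =>
      coin (if G.Adj e.1 e.2 then 1 / (8 * (max (G.degree e.1) (G.degree e.2) : ℕ)) else 0)).map
    fun x => lrOutput (pruneIn (pruneOut {e | x e = true}))

/-! ### The localized distributed synchronous matching -/

/-- The random choices of the vertex `v`: whether `v ∈ I` (with probability `1 / 2`) and, if so
and if `v` has a neighbour, a uniform neighbour `u`, to which `v` is linked with probability
`min {deg u, deg v} / deg u` (second component `some u`, otherwise `none`). -/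
noncomputable def dsChoice {V : Type*} [Fintype V] (G : SimpleGraph V) (v : V) :
    PMF (Bool × Option V) :=
  (coin (1 / 2)).bind fun inI =>
    if h : inI = true ∧ (G.neighborFinset v).Nonempty then
      (PMF.uniformOfFinset (G.neighborFinset v) h.2).bind fun u =>
        (coin ((min (G.degree u) (G.degree v) : ℕ) / (G.degree u : ℝ))).map fun accept =>
          (inI, if accept then some u else none)
    else PMF.pure (inI, none)

/-- The links `(v, u)` made by the choices `x`. -/
def dsLinks {V : Type*} (x : V → Bool × Option V) : Set (V × V) := {e | (x e.1).2 = some e.2}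

/-- The localized distributed synchronous matching of `G`: the vertices choose independently, and
a link `(v, u)` is kept if `u ∉ I` and it is the only link into `u`. -/
noncomputable def dsMatching {V : Type*} [Fintype V] (G : SimpleGraph V) : PMF (Set (Sym2 V)) :=
  (independentFamily fun v : V => dsChoice G v).map fun x =>
    {e | ∃ v u, e = s(v, u) ∧ (v, u) ∈ dsLinks x ∧ (x u).1 = false ∧ inDeg (dsLinks x) u = 1}

end LoadBalancing

/-! The proof is a drift argument. With `m` the rounded average and `excess x = x ^ 2 - |x|`, the
potential is the sum of `excess (Γ v - m)`. It is a non-negative integer that vanishes exactly on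
balanced configurations. Balancing a pair never increases it, by convexity, and the coin that
decides who gets the larger half does not affect it.

Two estimates give a geometric decay. The deterministic one, `sum_excess_le`, says that the drops
summed over all ordered pairs are at least `n / 16` times the potential; it uses that the deviations
from `m` sum to at most `n / 2` in absolute value. The probabilistic one,
`le_expect_edgeMarkovStep`, says that after one step of the graph, whatever it was before, every
pair is matched with probability at least `c = F * min p (1 - q) / (1 + 2 * n * max p (1 - q))`.
Together they shrink the expected potential by a factor `1 - c * n / 32` per round, and `c * n` is
at least of order `1 / r` once `max p (1 - q) ≥ θ / n`.

The initial potential is at most `n * Δ ^ 2`, so after order `r * log (Δ * n)` rounds its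
expectation is below `n ^ (-a)`. Markov's inequality at level `1` and integrality then give balance.

For the two concrete algorithms, fairness comes from a union bound over the choices that could spoil
a link, applied to both orientations of the edge; the two resulting events are disjoint. -/

section Auxiliary

open MeasureTheory ProbabilityTheory
open scoped Classical ENNReal

/-! ### Expectations over finite probability spaces -/

namespace PMF

/-- The expectation of a real function under a law on a finite type. -/
noncomputable def expect {α : Type*} [Fintype α] (P : PMF α) (g : α → ℝ) : ℝ :=
  ∑ a, (P a).toReal * g a

variable {α β : Type*} [Fintype α] [Fintype β]

theorem expect_mono (P : PMF α) {g h : α → ℝ} (H : ∀ a ∈ P.support, g a ≤ h a) :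
    P.expect g ≤ P.expect h := by
  refine Finset.sum_le_sum fun a _ => ?_
  by_cases ha : a ∈ P.support
  · exact mul_le_mul_of_nonneg_left (H a ha) ENNReal.toReal_nonneg
  · rw [mem_support_iff, not_not] at ha
    simp [ha]

theorem expect_add (P : PMF α) (g h : α → ℝ) :
    P.expect (fun a => g a + h a) = P.expect g + P.expect h := by
  simp [expect, mul_add, Finset.sum_add_distrib]

theorem expect_sub (P : PMF α) (g h : α → ℝ) :
    P.expect (fun a => g a - h a) = P.expect g - P.expect h := by
  simp [expect, mul_sub, Finset.sum_sub_distrib]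

theorem expect_mul_const (P : PMF α) (g : α → ℝ) (c : ℝ) :
    P.expect (fun a => g a * c) = P.expect g * c := by
  simp [expect, Finset.sum_mul, mul_assoc]

theorem expect_sum {ι : Type*} (P : PMF α) (s : Finset ι) (g : ι → α → ℝ) :
    P.expect (fun a => ∑ i ∈ s, g i a) = ∑ i ∈ s, P.expect (g i) := by
  simp only [expect, Finset.mul_sum]
  exact Finset.sum_comm

theorem sum_toReal (P : PMF α) : ∑ a, (P a).toReal = 1 := by
  rw [← ENNReal.toReal_sum fun a _ => P.apply_ne_top a, ← tsum_fintype (L := .unconditional _),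
    P.tsum_coe, ENNReal.toReal_one]

theorem expect_const (P : PMF α) (c : ℝ) : P.expect (fun _ => c) = c := by
  rw [expect, ← Finset.sum_mul, sum_toReal, one_mul]

theorem expect_nonneg (P : PMF α) {g : α → ℝ} (H : ∀ a, 0 ≤ g a) : 0 ≤ P.expect g :=
  Finset.sum_nonneg fun a _ => mul_nonneg ENNReal.toReal_nonneg (H a)

theorem expect_pure (a : α) (g : α → ℝ) : (PMF.pure a).expect g = g a := by
  rw [expect, Finset.sum_eq_single a] <;> simp +contextual [PMF.pure_apply]

theorem expect_bind (P : PMF α) (Q : α → PMF β) (g : β → ℝ) :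
    (P.bind Q).expect g = P.expect fun a => (Q a).expect g := by
  have h : ∀ b, ((P.bind Q) b).toReal = ∑ a, (P a).toReal * (Q a b).toReal := fun b => by
    rw [bind_apply, tsum_fintype, ENNReal.toReal_sum]
    · simp
    · exact fun a _ => ENNReal.mul_ne_top (P.apply_ne_top a) ((Q a).apply_ne_top b)
  simp only [expect, h, Finset.sum_mul, Finset.mul_sum]
  rw [Finset.sum_comm]
  simp only [mul_assoc]

theorem expect_map (P : PMF α) (f : α → β) (g : β → ℝ) :
    (P.map f).expect g = P.expect fun a => g (f a) := by
  have : P.map f = P.bind fun a => PMF.pure (f a) := rfl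
  rw [this, expect_bind]
  simp only [expect_pure]

theorem toReal_toOuterMeasure (P : PMF α) (s : Set α) :
    (P.toOuterMeasure s).toReal = P.expect fun a => if a ∈ s then 1 else 0 := by
  rw [toOuterMeasure_apply_fintype, ENNReal.toReal_sum]
  · refine Finset.sum_congr rfl fun a _ => ?_
    by_cases h : a ∈ s <;> simp [h]
  · intro a _
    by_cases h : a ∈ s <;> simp [h, P.apply_ne_top]

theorem expect_uniformOfFinset (s : Finset α) (hs : s.Nonempty) (g : α → ℝ) :
    (uniformOfFinset s hs).expect g = (∑ a ∈ s, g a) / s.card := by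
  simp only [expect, uniformOfFinset_apply]
  rw [div_eq_inv_mul, Finset.mul_sum, ← Finset.sum_subset (Finset.subset_univ s)]
  · refine Finset.sum_congr rfl fun a ha => ?_
    simp [ha]
  · intro a _ ha
    simp [ha]

end PMF

theorem expect_coin {x : ℝ} (h0 : 0 ≤ x) (h1 : x ≤ 1) (g : Bool → ℝ) :
    (coin x).expect g = x * g true + (1 - x) * g false := by
  simp [PMF.expect, coin, h0, ENNReal.toReal_sub_of_le, h1]

theorem coin_zero_support {b : Bool} (h : b ∈ (coin 0).support) : b = false := by
  rw [PMF.mem_support_iff] at h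
  cases b <;> simp_all [coin]

/-! ### Products over distinct coordinates of an independent family -/

section IndependentFamily

theorem mem_support_independentFamily {ι α : Type*} [Fintype ι] [Fintype α] {f : ι → PMF α}
    {x : ι → α} (h : x ∈ (independentFamily f).support) (i : ι) : x i ∈ (f i).support := by
  rw [PMF.mem_support_iff] at h ⊢
  exact fun hi => h (Finset.prod_eq_zero (Finset.mem_univ i) hi)

variable {ι α : Type*} [Fintype ι] [DecidableEq ι] [Fintype α]

theorem expect_independentFamily_prod (f : ι → PMF α) (J : Finset ι) (φ : ι → α → ℝ) :
    (independentFamily f).expect (fun x => ∏ i ∈ J, φ i (x i)) = ∏ i ∈ J, (f i).expect (φ i) := by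
  have key : ∀ ψ : ι → α → ℝ, (independentFamily f).expect (fun x => ∏ i, ψ i (x i)) =
      ∏ i, (f i).expect (ψ i) := fun ψ => by
    simp only [PMF.expect]
    rw [Fintype.prod_sum]
    refine Finset.sum_congr rfl fun x _ => ?_
    simp [independentFamily, ENNReal.toReal_prod, Finset.prod_mul_distrib]
  have h1 := key fun i a => if i ∈ J then φ i a else 1
  have h2 : ∀ i, (f i).expect (fun a => if i ∈ J then φ i a else 1) =
      if i ∈ J then (f i).expect (φ i) else 1 := fun i => by
    split_ifs
    · rfl
    · exact PMF.expect_const _ 1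
  simpa [h2, Finset.prod_ite_mem] using h1

theorem expect_independentFamily_one (f : ι → PMF α) (i : ι) (φ : α → ℝ) :
    (independentFamily f).expect (fun x => φ (x i)) = (f i).expect φ := by
  simpa using expect_independentFamily_prod f {i} fun _ => φ

theorem expect_independentFamily_two (f : ι → PMF α) {i j : ι} (hij : i ≠ j) (φ ψ : α → ℝ) :
    (independentFamily f).expect (fun x => φ (x i) * ψ (x j)) =
      (f i).expect φ * (f j).expect ψ := by
  simpa [Finset.prod_pair hij, hij.symm] using
    expect_independentFamily_prod f {i, j} fun k => if k = i then φ else ψ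

theorem expect_independentFamily_three (f : ι → PMF α) {i j k : ι} (hij : i ≠ j) (hik : i ≠ k)
    (hjk : j ≠ k) (φ ψ χ : α → ℝ) :
    (independentFamily f).expect (fun x => φ (x i) * ψ (x j) * χ (x k)) =
      (f i).expect φ * (f j).expect ψ * (f k).expect χ := by
  simpa [Finset.prod_insert, hij, hik, hjk, hij.symm, hik.symm, hjk.symm, mul_assoc] using
    expect_independentFamily_prod f {i, j, k} fun l => if l = i then φ else if l = j then ψ else χ

end IndependentFamily

/-! ### The potential -/

/-- A convex even function of the load, measured from the target, that vanishes exactly on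
`{-1, 0, 1}`. -/
def excess (x : ℤ) : ℤ := x ^ 2 - |x|

/-- The decrease of the total excess of two vertices when their loads are balanced. -/
def excessDrop (x y : ℤ) : ℤ :=
  excess x + excess y - excess ((x + y) / 2) - excess ((x + y + 1) / 2)

theorem excess_nonneg (x : ℤ) : 0 ≤ excess x := by
  rw [excess, ← sq_abs]
  rcases (abs_nonneg x).eq_or_lt with h | h
  · simp [← h]
  · nlinarith

theorem excess_eq_zero {x : ℤ} (h : excess x = 0) : x = -1 ∨ x = 0 ∨ x = 1 := by
  rw [excess, ← sq_abs] at h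
  have h1 : |x| * (|x| - 1) = 0 := by linarith
  rcases mul_eq_zero.1 h1 with h2 | h2
  · exact Or.inr (Or.inl (abs_eq_zero.1 h2))
  · rcases abs_eq (by norm_num : (0 : ℤ) ≤ 1) |>.1 (sub_eq_zero.1 h2) with h | h <;> simp [h]

theorem excess_neg (x : ℤ) : excess (-x) = excess x := by simp [excess]

theorem excess_of_nonneg {x : ℤ} (h : 0 ≤ x) : excess x = x ^ 2 - x := by
  rw [excess, abs_of_nonneg h]

theorem excess_of_nonpos {x : ℤ} (h : x ≤ 0) : excess x = x ^ 2 + x := by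
  rw [excess, abs_of_nonpos h]; ring

theorem excessDrop_neg (x y : ℤ) : excessDrop (-x) (-y) = excessDrop x y := by
  have h1 : (-x + -y) / 2 = -((x + y + 1) / 2) := by omega
  have h2 : (-x + -y + 1) / 2 = -((x + y) / 2) := by omega
  rw [excessDrop, excessDrop, h1, h2]
  simp only [excess_neg]
  ring

theorem excessDrop_comm (x y : ℤ) : excessDrop x y = excessDrop y x := by
  rw [excessDrop, excessDrop, add_comm y x]; ring

/-- The halves of a sum, by parity. -/
theorem halves_cases (x y : ℤ) : ∃ z, ((x + y) / 2 = z ∧ (x + y + 1) / 2 = z ∧ x + y = 2 * z) ∨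
    ((x + y) / 2 = z ∧ (x + y + 1) / 2 = z + 1 ∧ x + y = 2 * z + 1) :=
  ⟨(x + y) / 2, by omega⟩

/-- On one side of the target the linear terms cancel, which leaves the drop of the sum of squares,
`(x - y) ^ 2 / 2`; the `- 1` is the loss when `x + y` is odd. -/
theorem le_excessDrop_of_pos {x y : ℤ} (hx : 1 ≤ x) (hy : 1 ≤ y) :
    (x - y) ^ 2 - 1 ≤ 2 * excessDrop x y := by
  obtain ⟨z, ⟨h1, h2, h3⟩ | ⟨h1, h2, h3⟩⟩ := halves_cases x y
  all_goals
    rw [excessDrop, h1, h2, excess_of_nonneg (x := x) (by omega),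
      excess_of_nonneg (x := y) (by omega), excess_of_nonneg (x := z) (by omega)]
  · obtain rfl : y = 2 * z - x := by omega
    nlinarith
  · rw [excess_of_nonneg (x := z + 1) (by omega)]
    obtain rfl : y = 2 * z + 1 - x := by omega
    nlinarith

/-- Opposite signs cancel in `x + y`, so both halves have about half the size of the larger load at
most, and together at most half of its excess. -/
theorem excess_le_excessDrop {x y : ℤ} (hx : 0 ≤ x) (hy : y ≤ 0) :
    excess x ≤ 2 * excessDrop x y := by
  have ex := excess_nonneg x
  have ey := excess_nonneg y
  obtain ⟨z, ⟨h1, h2, h3⟩ | ⟨h1, h2, h3⟩⟩ := halves_cases x y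
  all_goals
    rw [excessDrop, h1, h2]
    rw [excess_of_nonneg hx] at ex ⊢
    rw [excess_of_nonpos hy] at ey ⊢
  · rcases le_total 0 z with hz | hz
    · rw [excess_of_nonneg hz]
      obtain rfl : x = 2 * z - y := by omega
      nlinarith [mul_nonneg hz (neg_nonneg.2 hy)]
    · rw [excess_of_nonpos hz]
      obtain rfl : y = 2 * z - x := by omega
      nlinarith [mul_nonneg hx (neg_nonneg.2 hz)]
  · rcases le_or_gt 0 z with hz | hz
    · rw [excess_of_nonneg hz, excess_of_nonneg (x := z + 1) (by omega)]
      obtain rfl : x = 2 * z + 1 - y := by omega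
      nlinarith [mul_nonneg hz (neg_nonneg.2 hy)]
    · rw [excess_of_nonpos hz.le, excess_of_nonpos (x := z + 1) (by omega)]
      obtain rfl : y = 2 * z + 1 - x := by omega
      nlinarith [mul_nonneg hx (neg_nonneg.2 (Int.add_one_le_iff.2 hz)), mul_nonneg hx hx]

theorem excess_le_excessDrop_of_nonpos {x y : ℤ} (hx : x ≤ 0) (hy : 0 ≤ y) :
    excess x ≤ 2 * excessDrop x y := by
  rw [← excess_neg x, ← excessDrop_neg]
  exact excess_le_excessDrop (by omega) (by omega)

theorem excessDrop_nonneg (x y : ℤ) : 0 ≤ excessDrop x y := by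
  have pos : ∀ x y : ℤ, 1 ≤ x → 1 ≤ y → 0 ≤ excessDrop x y := fun x y hx hy => by
    have := le_excessDrop_of_pos hx hy
    nlinarith [sq_nonneg (x - y)]
  have mix : ∀ x y : ℤ, 0 ≤ x → y ≤ 0 → 0 ≤ excessDrop x y := fun x y hx hy => by
    have := excess_le_excessDrop hx hy
    linarith [excess_nonneg x]
  -- A load equal to `0` counts as either sign and is sent to the mixed case, since `pos` needs both
  -- loads to be at least `1`.
  rcases le_total 0 x with hx | hx <;> rcases le_total 0 y with hy | hy
  · rcases hx.eq_or_lt with rfl | hx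
    · rw [excessDrop_comm]; exact mix y 0 hy le_rfl
    · rcases hy.eq_or_lt with rfl | hy
      · exact mix x 0 hx.le le_rfl
      · exact pos x y hx hy
  · exact mix x y hx hy
  · rw [excessDrop_comm]; exact mix y x hy hx
  · rw [← excessDrop_neg]
    rcases hx.eq_or_lt with rfl | hx
    · rw [excessDrop_comm]; exact mix _ _ (by omega) (by omega)
    · rcases hy.eq_or_lt with rfl | hy
      · exact mix _ _ (by omega) (by omega)
      · exact pos _ _ (by omega) (by omega)

/-! ### Total drop over all pairs against total excess -/

section Sums

variable {V : Type*} [Fintype V]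

/-- Few vertices at or below the target: the vertices above it interact among themselves, and
their excess is controlled by that of the vertices below. -/
theorem sum_excess_le_of_few_nonpos (x : V → ℤ) (hs : 2 * ∑ v, x v ≤ Fintype.card V)
    (hA : 8 * (Finset.univ.filter fun v => x v ≤ 0).card < Fintype.card V) :
    Fintype.card V * ∑ v, excess (x v) ≤ 16 * ∑ v, ∑ u, excessDrop (x v) (x u) := by
  set A := Finset.univ.filter fun v => x v ≤ 0 with hAdef
  set P := Finset.univ.filter fun v => ¬ x v ≤ 0 with hPdef
  have hP : ∀ {v}, v ∈ P → 1 ≤ x v := fun {v} hv => by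
    have := (Finset.mem_filter.1 hv).2; omega
  have hA' : ∀ {v}, v ∈ A → x v ≤ 0 := fun {v} hv => (Finset.mem_filter.1 hv).2
  have split : ∀ g : V → ℤ, ∑ v, g v = ∑ v ∈ A, g v + ∑ v ∈ P, g v := fun g =>
    (Finset.sum_filter_add_sum_filter_not _ _ _).symm
  have hcard : (A.card : ℤ) + P.card = Fintype.card V := by
    have := split fun _ => 1
    simpa using this.symm
  set W := ∑ v, ∑ u, excessDrop (x v) (x u) with hW
  -- the contribution of pairs with one end in `A` and one in `P`, and of pairs in `P`
  have hWA : W ≥ ∑ v ∈ A, ∑ u ∈ P, excessDrop (x v) (x u) +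
      ∑ v ∈ P, ∑ u ∈ P, excessDrop (x v) (x u) := by
    rw [hW, split]
    have : ∀ v, ∑ u ∈ P, excessDrop (x v) (x u) ≤ ∑ u, excessDrop (x v) (x u) := fun v =>
      Finset.sum_le_sum_of_subset_of_nonneg (Finset.subset_univ _)
        fun _ _ _ => excessDrop_nonneg _ _
    exact add_le_add (Finset.sum_le_sum fun v _ => this v) (Finset.sum_le_sum fun v _ => this v)
  have h1 : P.card * ∑ v ∈ A, excess (x v) ≤ 2 * ∑ v ∈ A, ∑ u ∈ P, excessDrop (x v) (x u) := by
    rw [Finset.mul_sum, Finset.mul_sum]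
    refine Finset.sum_le_sum fun v hv => ?_
    rw [Finset.mul_sum, ← nsmul_eq_mul, ← Finset.sum_const]
    exact Finset.sum_le_sum fun u hu =>
      excess_le_excessDrop_of_nonpos (hA' hv) (by linarith [hP hu])
  have h2 : 2 * P.card * ∑ v ∈ P, x v ^ 2 - 2 * (∑ v ∈ P, x v) ^ 2 - (P.card : ℤ) ^ 2 ≤
      2 * ∑ v ∈ P, ∑ u ∈ P, excessDrop (x v) (x u) := by
    have : ∑ v ∈ P, ∑ u ∈ P, ((x v - x u) ^ 2 - 1) ≤
        ∑ v ∈ P, ∑ u ∈ P, 2 * excessDrop (x v) (x u) := by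
      gcongr with v hv u hu
      exact le_excessDrop_of_pos (hP hv) (hP hu)
    have e : ∑ v ∈ P, ∑ u ∈ P, ((x v - x u) ^ 2 - 1) =
        2 * P.card * ∑ v ∈ P, x v ^ 2 - 2 * (∑ v ∈ P, x v) ^ 2 - (P.card : ℤ) ^ 2 := by
      have : ∀ v u, (x v - x u) ^ 2 - 1 = x v ^ 2 + x u ^ 2 - 2 * x v * x u - 1 := by
        intros; ring
      simp only [this, Finset.sum_sub_distrib, Finset.sum_add_distrib, Finset.sum_const,
        ← Finset.mul_sum, ← Finset.sum_mul, nsmul_eq_mul]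
      ring
    rw [e] at this
    simpa only [Finset.mul_sum] using this
  set FA := ∑ v ∈ A, excess (x v) with hFA
  set Neg := ∑ v ∈ A, (- x v) with hNeg
  have h3 : ∑ v ∈ P, excess (x v) ≤ ∑ v ∈ P, x v ^ 2 := by
    gcongr with v hv
    rw [excess]; linarith [abs_nonneg (x v)]
  -- With `y = -x v ≥ 0` this is `(y - 1) * (y - 2) ≥ 0`, true for integers; `h6` below is `(y - 1)
  -- ^ 2 ≥ 0`.
  have h4 : 2 * Neg - 2 * A.card ≤ FA := by
    rw [hFA, hNeg, Finset.mul_sum, Finset.card_eq_sum_ones, Nat.cast_sum, Finset.mul_sum,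
      ← Finset.sum_sub_distrib]
    refine Finset.sum_le_sum fun v hv => ?_
    rw [excess_of_nonpos (hA' hv)]
    push_cast
    have : (x v + 1) * (x v + 2) ≥ 0 := by
      rcases le_or_gt (x v) (-2) with h | h
      · nlinarith
      · have : x v = -1 ∨ x v = 0 := by have := hA' hv; omega
        rcases this with h | h <;> simp [h]
    nlinarith
  have h5 : Neg ^ 2 ≤ A.card * ∑ v ∈ A, x v ^ 2 := by
    have := sq_sum_le_card_mul_sum_sq (s := A) (f := fun v => - x v)
    simpa only [neg_sq] using this
  have h6 : ∑ v ∈ A, x v ^ 2 ≤ 2 * FA + A.card := by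
    rw [hFA, Finset.mul_sum, Finset.card_eq_sum_ones, Nat.cast_sum, ← Finset.sum_add_distrib]
    refine Finset.sum_le_sum fun v hv => ?_
    rw [excess_of_nonpos (hA' hv)]
    push_cast
    nlinarith [sq_nonneg (x v + 1)]
  have h7 : (P.card : ℤ) ≤ ∑ v ∈ P, x v := by
    rw [Finset.card_eq_sum_ones, Nat.cast_sum]
    exact Finset.sum_le_sum fun v hv => by simpa using hP hv
  have h8 : 2 * (∑ v ∈ P, x v - Neg) ≤ Fintype.card V := by
    rw [split] at hs
    rw [hNeg, Finset.sum_neg_distrib]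
    linarith
  rw [split, ← hFA]
  set S := ∑ v ∈ P, x v
  set Q := ∑ v ∈ P, x v ^ 2
  set R := ∑ v ∈ A, x v ^ 2
  set FP := ∑ v ∈ P, excess (x v)
  set WA := ∑ v ∈ A, ∑ u ∈ P, excessDrop (x v) (x u)
  set WP := ∑ v ∈ P, ∑ u ∈ P, excessDrop (x v) (x u)
  have hA8 : 8 * (A.card : ℤ) < Fintype.card V := by exact_mod_cast hA
  have ha0 : (0 : ℤ) ≤ A.card := by positivity
  have hQ0 : 0 ≤ Q := Finset.sum_nonneg fun v _ => sq_nonneg (x v)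
  have hWP0 : 0 ≤ WP := Finset.sum_nonneg fun v _ => Finset.sum_nonneg fun u _ =>
    excessDrop_nonneg _ _
  generalize (A.card : ℤ) = α at *
  generalize (P.card : ℤ) = N at *
  generalize (Fintype.card V : ℤ) = n at *
  have hn : 0 < n := by linarith
  -- Nearly all vertices are at least `1` above the target although the mean is at most `1 / 2`, so
  -- the few in `A` lie far below: `Neg ≥ N - n / 2`, hence `FA ≥ 2 * Neg - 2 * α ≥ n - 4 * α ≥ n /
  -- 2`.
  have hF : n ≤ 2 * FA := by linarith
  have hFA0 : 0 ≤ FA := by linarith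
  have hN : 7 * n ≤ 8 * N := by linarith
  have hNn : N ≤ n := by linarith
  have hS0 : 0 ≤ S := by linarith
  -- From `4 * S ^ 2 ≤ 2 * (n ^ 2 + 4 * Neg ^ 2)`, where `n ^ 2 ≤ 2 * n * FA` and, by Cauchy–Schwarz
  -- in `h5`, `4 * Neg ^ 2 ≤ (9 / 8) * n * FA`. So the squared mean that is lost in `h2` is paid for
  -- by the vertices below.
  have hS : 16 * S ^ 2 ≤ 25 * (n * FA) := by
    have b1 : (2 * S) ^ 2 ≤ (n + 2 * Neg) ^ 2 := by
      apply pow_le_pow_left₀ <;> linarith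
    have b2 : 8 * Neg ^ 2 ≤ n * (2 * FA + α) := by
      have : α * R ≤ α * (2 * FA + α) := by gcongr
      have : 8 * α * (2 * FA + α) ≤ n * (2 * FA + α) := by
        gcongr
      linarith
    have b3 : n * (8 * α) ≤ n * n := mul_le_mul_of_nonneg_left hA8.le hn.le
    have b4 : n * n ≤ n * (2 * FA) := mul_le_mul_of_nonneg_left hF hn.le
    linarith [sq_nonneg (n - 2 * Neg)]
  have hNF := mul_le_mul_of_nonneg_right hN hFA0
  have hN2 : N ^ 2 ≤ 2 * (n * FA) := by
    have b1 : N ^ 2 ≤ n ^ 2 := pow_le_pow_left₀ (by linarith) hNn 2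
    have b2 : n * n ≤ n * (2 * FA) := mul_le_mul_of_nonneg_left hF hn.le
    linarith
  have hNQ := mul_le_mul_of_nonneg_right hN hQ0
  have hnF : 0 ≤ n * FA := mul_nonneg hn.le hFA0
  have hFP : n * FP ≤ n * Q := mul_le_mul_of_nonneg_left h3 hn.le
  -- The pairs between `A` and `P` give `16 * WA ≥ 7 * n * FA`, while `(8 / 7) * WP ≥ n * Q - (41 /
  -- 14) * n * FA`; the rest of `WP` is dropped as non-negative.
  linarith

/-- If each closed side of the target holds at least an eighth of the vertices, every vertex meets
`n / 8` partners of opposite sign, and each such pair drops by half its excess. Otherwise one side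
is sparse and the previous lemma applies, after a change of sign if needed. -/
theorem sum_excess_le (x : V → ℤ) (hs : |2 * ∑ v, x v| ≤ Fintype.card V) :
    Fintype.card V * ∑ v, excess (x v) ≤ 16 * ∑ v, ∑ u, excessDrop (x v) (x u) := by
  obtain ⟨hs1, hs2⟩ := abs_le.1 hs
  by_cases hA : 8 * (Finset.univ.filter fun v => x v ≤ 0).card < Fintype.card V
  · exact sum_excess_le_of_few_nonpos x hs2 hA
  by_cases hB : 8 * (Finset.univ.filter fun v => 0 ≤ x v).card < Fintype.card V
  · have := sum_excess_le_of_few_nonpos (fun v => - x v)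
      (by rw [Finset.sum_neg_distrib]; linarith) (by simpa using hB)
    simpa only [excess_neg, excessDrop_neg] using this
  have hA : (Fintype.card V : ℤ) ≤ 8 * (Finset.univ.filter fun v => x v ≤ 0).card := by
    exact_mod_cast not_lt.1 hA
  have hB : (Fintype.card V : ℤ) ≤ 8 * (Finset.univ.filter fun v => 0 ≤ x v).card := by
    exact_mod_cast not_lt.1 hB
  rw [Finset.mul_sum, Finset.mul_sum]
  refine Finset.sum_le_sum fun v _ => ?_
  have bound : ∀ B : Finset V, (∀ u ∈ B, excess (x v) ≤ 2 * excessDrop (x v) (x u)) →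
      (Fintype.card V : ℤ) ≤ 8 * B.card →
      Fintype.card V * excess (x v) ≤ 16 * ∑ u, excessDrop (x v) (x u) := fun B h1 h2 => by
    have h3 : ∑ u ∈ B, excess (x v) ≤ ∑ u ∈ B, 2 * excessDrop (x v) (x u) := Finset.sum_le_sum h1
    rw [Finset.sum_const, nsmul_eq_mul, ← Finset.mul_sum] at h3
    have h4 : ∑ u ∈ B, excessDrop (x v) (x u) ≤ ∑ u, excessDrop (x v) (x u) :=
      Finset.sum_le_sum_of_subset_of_nonneg (Finset.subset_univ _)
        fun _ _ _ => excessDrop_nonneg _ _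
    nlinarith [excess_nonneg (x v)]
  rcases le_total 0 (x v) with hv | hv
  · exact bound _ (fun u hu => excess_le_excessDrop hv (Finset.mem_filter.1 hu).2) hA
  · exact bound _ (fun u hu => excess_le_excessDrop_of_nonpos hv (Finset.mem_filter.1 hu).2) hB

end Sums

/-! ### The effect of one balancing step -/

section Balance

variable {V : Type*}

theorem IsMatchingOf.unique {G : SimpleGraph V} {M : Set (Sym2 V)} (hM : IsMatchingOf G M)
    {v u u' : V} (h : s(v, u) ∈ M) (h' : s(v, u') ∈ M) : u = u' := by
  by_contra hne
  exact hM.2 _ h _ h' (fun e => hne (Sym2.congr_right.1 e)) v (by simp)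

theorem IsMatchingOf.ne {G : SimpleGraph V} {M : Set (Sym2 V)} (hM : IsMatchingOf G M)
    {v u : V} (h : s(v, u) ∈ M) : v ≠ u :=
  G.ne_of_adj (hM.1 h)

/-- The vertex matched to `v` by `M`, or `v` itself if there is none. -/
noncomputable def partner (M : Set (Sym2 V)) (v : V) : V :=
  if h : ∃ u, s(v, u) ∈ M then h.choose else v

theorem IsMatchingOf.partner_eq {G : SimpleGraph V} {M : Set (Sym2 V)} (hM : IsMatchingOf G M)
    {v u : V} (h : s(v, u) ∈ M) : partner M v = u := by
  have hex : ∃ u, s(v, u) ∈ M := ⟨u, h⟩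
  rw [partner, dif_pos hex]
  exact hM.unique hex.choose_spec h

theorem partner_eq_self {M : Set (Sym2 V)} {v : V} (h : ¬ ∃ u, s(v, u) ∈ M) :
    partner M v = v := dif_neg h

theorem IsMatchingOf.involutive_partner {G : SimpleGraph V} {M : Set (Sym2 V)}
    (hM : IsMatchingOf G M) : Function.Involutive (partner M) := by
  intro v
  by_cases h : ∃ u, s(v, u) ∈ M
  · obtain ⟨u, hu⟩ := h
    rw [hM.partner_eq hu]
    exact hM.partner_eq (by rwa [Sym2.eq_swap])
  · rw [partner_eq_self h, partner_eq_self h]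

theorem IsMatchingOf.balanceAlong_of_mem {G : SimpleGraph V} {M : Set (Sym2 V)}
    (hM : IsMatchingOf G M) (Γ : V → ℕ) (w : Sym2 V → V) {v u : V} (h : s(v, u) ∈ M) :
    balanceAlong Γ M w v =
      if w s(v, u) = v then (Γ v + Γ u + 1) / 2 else (Γ v + Γ u) / 2 := by
  have hex : ∃ u, s(v, u) ∈ M := ⟨u, h⟩
  have : hex.choose = u := hM.unique hex.choose_spec h
  rw [balanceAlong, dif_pos hex, this]

theorem balanceAlong_of_unmatched (Γ : V → ℕ) {M : Set (Sym2 V)} (w : Sym2 V → V) {v : V}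
    (h : ¬ ∃ u, s(v, u) ∈ M) : balanceAlong Γ M w v = Γ v := dif_neg h

/-- The loads of a vertex and its partner after balancing. -/
theorem IsMatchingOf.balanceAlong_pair {G : SimpleGraph V} {M : Set (Sym2 V)}
    (hM : IsMatchingOf G M) (Γ : V → ℕ) {w : Sym2 V → V} (hw : ∀ e, w e ∈ e) {v u : V}
    (h : s(v, u) ∈ M) :
    (balanceAlong Γ M w v = (Γ v + Γ u + 1) / 2 ∧ balanceAlong Γ M w u = (Γ v + Γ u) / 2) ∨
    (balanceAlong Γ M w v = (Γ v + Γ u) / 2 ∧ balanceAlong Γ M w u = (Γ v + Γ u + 1) / 2) := by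
  have h' : s(u, v) ∈ M := by rwa [Sym2.eq_swap]
  rw [hM.balanceAlong_of_mem Γ w h, hM.balanceAlong_of_mem Γ w h', Sym2.eq_swap (a := u)]
  have hne := hM.ne h
  rcases Sym2.mem_iff.1 (hw s(v, u)) with e | e
  · left; simp [e, hne, add_comm]
  · right; simp [e, hne.symm, add_comm]

variable [Fintype V]

/-- Reindexing by the involution `partner M` replaces sums over matched edges by sums over vertices,
so no orientation of the edges has to be chosen. -/
theorem IsMatchingOf.sum_partner {G : SimpleGraph V} {M : Set (Sym2 V)}
    (hM : IsMatchingOf G M) {R : Type*} [AddCommMonoid R] (g : V → R) :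
    ∑ v, g (partner M v) = ∑ v, g v :=
  Equiv.sum_comp (hM.involutive_partner.toPerm _) g

theorem IsMatchingOf.sum_balanceAlong {G : SimpleGraph V} {M : Set (Sym2 V)}
    (hM : IsMatchingOf G M) (Γ : V → ℕ) {w : Sym2 V → V} (hw : ∀ e, w e ∈ e) :
    ∑ v, balanceAlong Γ M w v = ∑ v, Γ v := by
  have key : ∑ v, (balanceAlong Γ M w v + balanceAlong Γ M w (partner M v)) =
      ∑ v, (Γ v + Γ (partner M v)) := by
    refine Finset.sum_congr rfl fun v _ => ?_
    by_cases h : ∃ u, s(v, u) ∈ M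
    · obtain ⟨u, hu⟩ := h
      rw [hM.partner_eq hu]
      have := hM.balanceAlong_pair Γ hw hu
      omega
    · rw [partner_eq_self h, balanceAlong_of_unmatched Γ w h]
  rw [Finset.sum_add_distrib, Finset.sum_add_distrib, hM.sum_partner, hM.sum_partner] at key
  omega

/-- The total excess of a configuration over the target `m`. -/
def totalExcess (m : ℤ) (Γ : V → ℕ) : ℤ := ∑ v, excess (Γ v - m)

theorem totalExcess_nonneg (m : ℤ) (Γ : V → ℕ) : 0 ≤ totalExcess m Γ :=
  Finset.sum_nonneg fun _ _ => excess_nonneg _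

/-- The choice `w` only swaps the two halves of a pair, so it has no effect on the total excess. The
factors `2` arise because the double sum meets every edge in both orders. -/
theorem IsMatchingOf.totalExcess_balanceAlong {G : SimpleGraph V} {M : Set (Sym2 V)}
    (hM : IsMatchingOf G M) (m : ℤ) (Γ : V → ℕ) {w : Sym2 V → V} (hw : ∀ e, w e ∈ e) :
    2 * totalExcess m (balanceAlong Γ M w) +
      ∑ v, ∑ u, (if s(v, u) ∈ M then excessDrop (Γ v - m) (Γ u - m) else 0) =
    2 * totalExcess m Γ := by
  have key : ∑ v, (excess (balanceAlong Γ M w v - m) +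
        excess (balanceAlong Γ M w (partner M v) - m) +
        ∑ u, (if s(v, u) ∈ M then excessDrop (Γ v - m) (Γ u - m) else 0)) =
      ∑ v, (excess (Γ v - m) + excess (Γ (partner M v) - m)) := by
    refine Finset.sum_congr rfl fun v _ => ?_
    by_cases h : ∃ u, s(v, u) ∈ M
    · obtain ⟨u, hu⟩ := h
      rw [hM.partner_eq hu, Finset.sum_eq_single u
        (fun u' _ hne => if_neg fun h' => hne (hM.unique h' hu)) (by simp), if_pos hu, excessDrop]
      -- Subtracting `m` from both loads shifts their sum by an even number, so it commutes with
      -- both roundings.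
      have e1 : (((Γ v + Γ u) / 2 : ℕ) : ℤ) - m = ((Γ v - m) + (Γ u - m)) / 2 := by omega
      have e2 : (((Γ v + Γ u + 1) / 2 : ℕ) : ℤ) - m = ((Γ v - m) + (Γ u - m) + 1) / 2 := by omega
      rcases hM.balanceAlong_pair Γ hw hu with ⟨h1, h2⟩ | ⟨h1, h2⟩ <;> rw [h1, h2, e1, e2] <;> ring
    · have : ∀ u, s(v, u) ∉ M := fun u hu => h ⟨u, hu⟩
      simp [partner_eq_self h, balanceAlong_of_unmatched Γ w h, this]
  rw [Finset.sum_add_distrib, Finset.sum_add_distrib, Finset.sum_add_distrib,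
    hM.sum_partner fun v => excess (balanceAlong Γ M w v - m),
    hM.sum_partner fun v => excess (Γ v - m)] at key
  simp only [totalExcess]
  linarith

theorem mem_support_balanceStep {Γ Γ' : V → ℕ} {M : Set (Sym2 V)}
    (h : Γ' ∈ (balanceStep Γ M).support) :
    ∃ w : Sym2 V → V, (∀ e, w e ∈ e) ∧ Γ' = balanceAlong Γ M w := by
  rw [balanceStep, PMF.mem_support_map_iff] at h
  obtain ⟨w, hw, rfl⟩ := h
  refine ⟨w, fun e => ?_, rfl⟩
  have := mem_support_independentFamily hw e
  exact Sym2.mem_toFinset.1 ((PMF.mem_support_uniformOfFinset_iff _ _).1 this)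

end Balance

/-! ### The probability that two given vertices are matched in an edge-Markovian graph -/

section EdgeMarkov

variable {V : Type*} [Fintype V]

theorem card_incident_le (v u : V) :
    ((Finset.univ.filter fun f : Sym2 V => f ≠ s(v, u) ∧ (v ∈ f ∨ u ∈ f)).card : ℝ) ≤
      2 * Fintype.card V := by
  have h : (Finset.univ.filter fun f : Sym2 V => f ≠ s(v, u) ∧ (v ∈ f ∨ u ∈ f)) ⊆
      (Finset.univ.image fun w => s(v, w)) ∪ (Finset.univ.image fun w => s(u, w)) := by
    intro f hf
    simp only [Finset.mem_filter, Finset.mem_univ, true_and] at hf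
    simp only [Finset.mem_union, Finset.mem_image, Finset.mem_univ, true_and]
    exact hf.2.imp (fun h => ⟨_, Sym2.other_spec h⟩) (fun h => ⟨_, Sym2.other_spec h⟩)
  have := (Finset.card_le_card h).trans (Finset.card_union_le _ _)
  have h1 := Finset.card_image_le (s := Finset.univ) (f := fun w => s(v, w))
  have h2 := Finset.card_image_le (s := Finset.univ) (f := fun w => s(u, w))
  rw [Finset.card_univ] at h1 h2
  have h3 := this.trans (add_le_add h1 h2)
  rw [← two_mul] at h3
  have h4 : (_ : ℝ) ≤ ((2 * Fintype.card V : ℕ) : ℝ) := Nat.cast_le.2 h3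
  rwa [Nat.cast_mul, Nat.cast_two] at h4

theorem degree_le_one_add_sum {G : SimpleGraph V} {x : Sym2 V → Bool}
    (hG : ∀ a b, G.Adj a b → x s(a, b) = true) (B : Finset (Sym2 V)) (v u : V)
    (hB : ∀ w, w ≠ v → w ≠ u → s(v, w) ∈ B) :
    (G.degree v : ℝ) ≤ 1 + ∑ f ∈ B, if x f = true then (1 : ℝ) else 0 := by
  have h : ((G.neighborFinset v).erase u).card ≤ (B.filter fun f => x f = true).card :=
    Finset.card_le_card_of_injOn (fun w => s(v, w)) (fun w hw => by
      simp only [Finset.coe_erase, SimpleGraph.coe_neighborFinset, Set.mem_sdiff,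
        SimpleGraph.mem_neighborSet, Set.mem_singleton_iff] at hw
      simpa using ⟨hB w hw.1.ne' hw.2, hG v w hw.1⟩)
      fun w _ w' _ e => Sym2.congr_right.1 e
  have h4 := Finset.pred_card_le_card_erase (s := G.neighborFinset v) (a := u)
  rw [SimpleGraph.card_neighborFinset_eq_degree] at h4
  rw [Finset.sum_boole]
  have h5 : G.degree v ≤ 1 + (B.filter fun f => x f = true).card := by omega
  exact_mod_cast h5

/-- The pair `e` is an edge with probability at least `min p (1 - q)`, and the other pairs at its
ends, independent of `e`, raise the degrees to at most `K` on average. Convexity of the reciprocal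
then gives `1 / K`, as in Jensen's inequality. -/
theorem le_expect_edgeMarkovStep {p q F : ℝ} (hp : 0 < p) (hp1 : p ≤ 1) (hq : 0 ≤ q)
    (hq1 : q < 1) (hF : 0 ≤ F) (G : SimpleGraph V) {v u : V} (hne : v ≠ u)
    (φ : SimpleGraph V → ℝ) (hφ0 : ∀ G', 0 ≤ φ G')
    (hφ : ∀ G', G'.Adj v u → F / (max (G'.degree v) (G'.degree u) : ℕ) ≤ φ G') :
    F * min p (1 - q) / (1 + 2 * Fintype.card V * max p (1 - q)) ≤
      (edgeMarkovStep p q G).expect φ := by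
  set e := s(v, u) with he
  set B := Finset.univ.filter fun f : Sym2 V => f ≠ e ∧ (v ∈ f ∨ u ∈ f) with hB
  set K : ℝ := 1 + 2 * Fintype.card V * max p (1 - q) with hK
  set χ : Bool → ℝ := fun b => if b = true then 1 else 0 with hχ
  set π : Sym2 V → ℝ := fun f => if f ∈ G.edgeSet then 1 - q else p with hπ
  have hM0 : 0 < max p (1 - q) := lt_max_of_lt_left hp
  have hK0 : 0 < K := by positivity
  have hπ0 : ∀ f, 0 ≤ π f := fun f => by simp only [hπ]; split_ifs <;> linarith
  have hπ1 : ∀ f, π f ≤ 1 := fun f => by simp only [hπ]; split_ifs <;> linarith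
  have hπM : ∀ f, π f ≤ max p (1 - q) := fun f => by simp only [hπ]; split_ifs <;> simp
  have hπm : min p (1 - q) ≤ π e := by simp only [hπ]; split_ifs <;> simp
  have hc : ∀ f, (coin (π f)).expect χ = π f := fun f => by
    rw [expect_coin (hπ0 f) (hπ1 f)]; simp [hχ]
  rw [edgeMarkovStep, PMF.expect_map]
  -- When `e` is present, `1 / N` is bounded below by its tangent line at `K`, namely `2 / K - N / K
  -- ^ 2`. This is linear in the indicators, so independence of `e` and one further pair at a time
  -- suffices, without conditioning.
  have point : ∀ x : Sym2 V → Bool,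
      F * (χ (x e) * (2 / K - 1 / K ^ 2) - ∑ f ∈ B, χ (x e) * χ (x f) * (1 / K ^ 2)) ≤
        φ (SimpleGraph.fromEdgeSet {e | x e = true}) := fun x => by
    by_cases hx : x e = true
    · obtain ⟨G', hG'⟩ : ∃ G', G' = SimpleGraph.fromEdgeSet {e | x e = true} := ⟨_, rfl⟩
      rw [← hG']
      have hx' : ∀ a b, G'.Adj a b → x s(a, b) = true := fun a b h => by
        rw [hG', SimpleGraph.fromEdgeSet_adj] at h
        exact h.1
      have hadj : G'.Adj v u := by
        rw [hG', SimpleGraph.fromEdgeSet_adj]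
        exact ⟨hx, hne⟩
      refine le_trans ?_ (hφ G' hadj)
      set N : ℝ := 1 + ∑ f ∈ B, χ (x f) with hN
      have hd1 : (G'.degree v : ℝ) ≤ N :=
        degree_le_one_add_sum hx' B v u fun w hw1 hw2 => by
          simp [hB, he, hw1, hw2]
      have hd2 : (G'.degree u : ℝ) ≤ N :=
        degree_le_one_add_sum hx' B u v fun w hw1 hw2 => by
          simp [hB, he, hw1, hw2]
      have hd0 : 0 < G'.degree v := (G'.degree_pos_iff_exists_adj v).2 ⟨u, hadj⟩
      have hmax : ((max (G'.degree v) (G'.degree u) : ℕ) : ℝ) ≤ N := by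
        rw [Nat.cast_max]; exact max_le hd1 hd2
      have hmax0 : (0 : ℝ) < (max (G'.degree v) (G'.degree u) : ℕ) := by
        exact_mod_cast lt_max_of_lt_left hd0
      have hN0 : 0 < N := hmax0.trans_le hmax
      have hx1 : χ (x e) = 1 := by simp [hχ, hx]
      simp only [hx1, one_mul]
      rw [← Finset.sum_mul, div_eq_mul_one_div F]
      refine mul_le_mul_of_nonneg_left ?_ hF
      refine le_trans ?_ (one_div_le_one_div_of_le hmax0 hmax)
      have : 2 / K - 1 / K ^ 2 - (∑ f ∈ B, χ (x f)) * (1 / K ^ 2) =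
          1 / N - (N - K) ^ 2 / (N * K ^ 2) := by
        rw [show ∑ f ∈ B, χ (x f) = N - 1 by rw [hN]; ring]
        field_simp
        ring
      rw [this]
      have : 0 ≤ (N - K) ^ 2 / (N * K ^ 2) := by positivity
      linarith
    · have hx1 : χ (x e) = 0 := by simp [hχ, hx]
      simpa [hx1] using hφ0 _
  refine le_trans ?_ (PMF.expect_mono _ fun x _ => point x)
  have hlin : (independentFamily fun f => coin (π f)).expect (fun x =>
      F * (χ (x e) * (2 / K - 1 / K ^ 2) - ∑ f ∈ B, χ (x e) * χ (x f) * (1 / K ^ 2))) =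
      F * (π e * (2 / K - 1 / K ^ 2) - ∑ f ∈ B, π e * π f * (1 / K ^ 2)) := by
    simp only [mul_comm F]
    rw [PMF.expect_mul_const, PMF.expect_sub, PMF.expect_mul_const, PMF.expect_sum,
      expect_independentFamily_one (fun f => coin (π f)) e χ, hc]
    congr 2
    refine Finset.sum_congr rfl fun f hf => ?_
    rw [PMF.expect_mul_const, expect_independentFamily_two (fun f => coin (π f)) _ χ χ, hc, hc]
    exact (Finset.mem_filter.1 hf).2.1.symm
  refine le_trans ?_ hlin.ge
  rw [mul_div_assoc]
  refine mul_le_mul_of_nonneg_left ?_ hF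
  have hsum : ∑ f ∈ B, π f ≤ K - 1 := by
    calc ∑ f ∈ B, π f ≤ ∑ _f ∈ B, max p (1 - q) := Finset.sum_le_sum fun f _ => hπM f
      _ = B.card * max p (1 - q) := by rw [Finset.sum_const, nsmul_eq_mul]
      _ ≤ 2 * Fintype.card V * max p (1 - q) :=
        mul_le_mul_of_nonneg_right (card_incident_le v u) hM0.le
      _ = K - 1 := by rw [hK]; ring
  rw [← Finset.sum_mul, ← Finset.mul_sum]
  calc min p (1 - q) / K ≤ π e / K := by gcongr
    _ = π e * (2 / K - 1 / K ^ 2) - π e * (K - 1) * (1 / K ^ 2) := by field_simp; ring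
    _ ≤ _ := by
      have : π e * (∑ f ∈ B, π f) * (1 / K ^ 2) ≤ π e * (K - 1) * (1 / K ^ 2) := by
        gcongr
      linarith

end EdgeMarkov

/-! ### Expectations of non-negative functions -/

namespace PMF

/-- The expectation of an extended non-negative function under a discrete law. -/
noncomputable def eexpect {α : Type*} (P : PMF α) (g : α → ℝ≥0∞) : ℝ≥0∞ := ∑' a, P a * g a

variable {α β : Type*}

theorem eexpect_mono (P : PMF α) {g h : α → ℝ≥0∞} (H : ∀ a ∈ P.support, g a ≤ h a) :
    P.eexpect g ≤ P.eexpect h := by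
  refine ENNReal.tsum_le_tsum fun a => ?_
  by_cases ha : a ∈ P.support
  · exact mul_le_mul_right (H a ha) _
  · rw [mem_support_iff, not_not] at ha
    simp [ha]

theorem eexpect_const (P : PMF α) (c : ℝ≥0∞) : P.eexpect (fun _ => c) = c := by
  rw [eexpect, ENNReal.tsum_mul_right, P.tsum_coe, one_mul]

theorem eexpect_le_of_forall_le (P : PMF α) {g : α → ℝ≥0∞} {c : ℝ≥0∞}
    (H : ∀ a ∈ P.support, g a ≤ c) : P.eexpect g ≤ c :=
  (P.eexpect_mono H).trans_eq (P.eexpect_const c)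

theorem eexpect_const_mul (P : PMF α) (c : ℝ≥0∞) (g : α → ℝ≥0∞) :
    P.eexpect (fun a => c * g a) = c * P.eexpect g := by
  simp only [eexpect, mul_left_comm _ c, ENNReal.tsum_mul_left]

theorem eexpect_bind (P : PMF α) (Q : α → PMF β) (g : β → ℝ≥0∞) :
    (P.bind Q).eexpect g = P.eexpect fun a => (Q a).eexpect g := by
  simp only [eexpect, bind_apply, ← ENNReal.tsum_mul_right, ← ENNReal.tsum_mul_left]
  rw [ENNReal.tsum_comm]
  simp only [mul_assoc]

theorem eexpect_map (P : PMF α) (f : α → β) (g : β → ℝ≥0∞) :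
    (P.map f).eexpect g = P.eexpect fun a => g (f a) := by
  have : P.map f = P.bind fun a => PMF.pure (f a) := rfl
  rw [this, eexpect_bind]
  congr 1 with a
  rw [eexpect, tsum_eq_single (f a)] <;> simp +contextual [PMF.pure_apply]

theorem lintegral_toMeasure [MeasurableSpace α] [Countable α] [MeasurableSingletonClass α]
    (P : PMF α) (g : α → ℝ≥0∞) : ∫⁻ a, g a ∂P.toMeasure = P.eexpect g := by
  rw [lintegral_countable', eexpect]
  simp only [P.toMeasure_apply_singleton _ (measurableSet_singleton _), mul_comm]

/-- The bridge between the two expectations: `eexpect` allows configurations in an infinite type and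
the value `⊤`, while `expect` allows subtraction. Signs are needed only on the support, because the
excess after balancing is known to be non-negative only for matchings. -/
theorem eexpect_le_ofReal [Fintype α] (P : PMF α) {h : α → ℝ≥0∞} {g : α → ℝ}
    (h0 : ∀ a ∈ P.support, 0 ≤ g a) (H : ∀ a ∈ P.support, h a ≤ ENNReal.ofReal (g a)) :
    P.eexpect h ≤ ENNReal.ofReal (P.expect g) := by
  refine (P.eexpect_mono H).trans_eq ?_
  rw [eexpect, tsum_fintype, expect, ENNReal.ofReal_sum_of_nonneg]
  · refine Finset.sum_congr rfl fun a _ => ?_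
    rw [ENNReal.ofReal_mul ENNReal.toReal_nonneg, ENNReal.ofReal_toReal (P.apply_ne_top a)]
  · intro a _
    by_cases ha : a ∈ P.support
    · exact mul_nonneg ENNReal.toReal_nonneg (h0 a ha)
    · rw [mem_support_iff, not_not] at ha
      simp [ha]

end PMF

/-! ### The law of the execution, one round at a time -/

section Execution

variable {V : Type*} [Fintype V]

instance (A : MatchingRule V) (p q : ℝ) (G₀ : SimpleGraph V) (Γ₀ : V → ℕ) :
    IsProbabilityMeasure (executionLaw A p q G₀ Γ₀) := by
  have : IsProbabilityMeasure (firstRound A G₀ Γ₀).toMeasure :=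
    PMF.toMeasure.isProbabilityMeasure _
  unfold executionLaw
  infer_instance

theorem map_executionLaw_zero (A : MatchingRule V) (p q : ℝ) (G₀ : SimpleGraph V) (Γ₀ : V → ℕ) :
    (executionLaw A p q G₀ Γ₀).map (fun ω => ω 0) = (firstRound A G₀ Γ₀).toMeasure := by
  have h1 : (fun ω : ℕ → Round V => ω 0) =
      (fun y : ((i : Finset.Iic 0) → (fun _ : ℕ => Round V) i) => y ⟨0, by simp⟩) ∘
        (Preorder.frestrictLe (π := fun _ : ℕ => Round V) 0) := rfl
  rw [h1, ← Measure.map_map (by fun_prop) (by fun_prop), executionLaw, Kernel.trajMeasure,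
    Measure.map_comp _ _ (by fun_prop), Kernel.traj_map_frestrictLe, Kernel.partialTraj_self,
    Measure.id_comp, Measure.map_map (by fun_prop) (by fun_prop)]
  exact Measure.map_id

theorem lintegral_executionLaw_zero (A : MatchingRule V) (p q : ℝ) (G₀ : SimpleGraph V)
    (Γ₀ : V → ℕ) (f : Round V → ℝ≥0∞) :
    ∫⁻ ω, f (ω 0) ∂executionLaw A p q G₀ Γ₀ = (firstRound A G₀ Γ₀).eexpect f := by
  rw [← PMF.lintegral_toMeasure, ← map_executionLaw_zero A p q,
    lintegral_map (measurable_of_countable f) (by fun_prop)]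

/-- The joint law of the history and the next round is the history composed with `roundKernel`, so a
one-step bound can be integrated. It is required for every history, even impossible ones; a bound
`g` that sees only the last round can be iterated. -/
theorem lintegral_executionLaw_succ_le (A : MatchingRule V) (p q : ℝ) (G₀ : SimpleGraph V)
    (Γ₀ : V → ℕ) (t : ℕ) (f g : Round V → ℝ≥0∞)
    (H : ∀ h : Fin (t + 1) → Round V, (nextRound A p q t h).eexpect f ≤ g (h (Fin.last t))) :
    ∫⁻ ω, f (ω (t + 1)) ∂executionLaw A p q G₀ Γ₀ ≤
      ∫⁻ ω, g (ω t) ∂executionLaw A p q G₀ Γ₀ := by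
  have : IsProbabilityMeasure (firstRound A G₀ Γ₀).toMeasure :=
    PMF.toMeasure.isProbabilityMeasure _
  have hf : Measurable f := measurable_of_countable f
  have key := Kernel.map_frestrictLe_trajMeasure_compProd_eq_map_trajMeasure
    (X := fun _ : ℕ => Round V) (μ₀ := (firstRound A G₀ Γ₀).toMeasure)
    (κ := roundKernel A p q) (a := t)
  change (executionLaw A p q G₀ Γ₀).map _ ⊗ₘ _ = (executionLaw A p q G₀ Γ₀).map _ at key
  set μ := executionLaw A p q G₀ Γ₀
  have hm : Measurable fun ω : ℕ → Round V =>
      (Preorder.frestrictLe (π := fun _ : ℕ => Round V) t ω, ω (t + 1)) := by fun_prop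
  have e1 : ∫⁻ ω, f (ω (t + 1)) ∂μ =
      ∫⁻ z, f z.2 ∂(μ.map fun ω : ℕ → Round V =>
        (Preorder.frestrictLe (π := fun _ : ℕ => Round V) t ω, ω (t + 1))) :=
    (lintegral_map (f := fun z => f z.2) (by fun_prop) hm).symm
  rw [e1, ← key, Measure.lintegral_compProd (f := fun z => f z.2) (by fun_prop)]
  rw [lintegral_map (measurable_of_countable _) (by fun_prop)]
  refine lintegral_mono fun ω => ?_
  simp only [roundKernel, Kernel.coe_mk]
  rw [PMF.lintegral_toMeasure]
  exact H _

end Execution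

/-! ### The drift of the potential -/

section Drift

variable {V : Type*} [Fintype V]

/-- The total excess over `m`, made infinite on configurations whose number of tokens is not
`S`. -/
noncomputable def potential (m : ℤ) (S : ℕ) (Γ : V → ℕ) : ℝ≥0∞ :=
  if ∑ v, Γ v = S then ENNReal.ofReal (totalExcess m Γ) else ⊤

/-- The expected potential after balancing in the given round. -/
noncomputable def nextPotential (m : ℤ) (S : ℕ) (R : Round V) : ℝ≥0∞ :=
  (balanceStep R.config R.matching).eexpect (potential m S)

/-- The total excess after balancing along the matching `M`. -/
noncomputable def excessAfter (m : ℤ) (Γ : V → ℕ) (M : Set (Sym2 V)) : ℝ :=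
  totalExcess m Γ -
    ∑ v, ∑ u, (if s(v, u) ∈ M then 1 else 0) * ((excessDrop (Γ v - m) (Γ u - m) : ℝ) / 2)

theorem IsMatchingOf.totalExcess_balanceAlong_eq {G : SimpleGraph V} {M : Set (Sym2 V)}
    (hM : IsMatchingOf G M) (m : ℤ) (Γ : V → ℕ) {w : Sym2 V → V} (hw : ∀ e, w e ∈ e) :
    (totalExcess m (balanceAlong Γ M w) : ℝ) = excessAfter m Γ M := by
  have h := congrArg (Int.cast : ℤ → ℝ) (hM.totalExcess_balanceAlong m Γ hw)
  push_cast at h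
  have e : ∑ v, ∑ u, (if s(v, u) ∈ M then (1 : ℝ) else 0) *
        ((excessDrop (Γ v - m) (Γ u - m) : ℝ) / 2) =
      (∑ v, ∑ u, (if s(v, u) ∈ M then (excessDrop (Γ v - m) (Γ u - m) : ℝ) else 0)) / 2 := by
    simp only [Finset.sum_div]
    refine Finset.sum_congr rfl fun v _ => Finset.sum_congr rfl fun u _ => ?_
    split_ifs <;> simp
  rw [excessAfter, e]
  linarith

theorem IsMatchingOf.excessAfter_nonneg {G : SimpleGraph V} {M : Set (Sym2 V)}
    (hM : IsMatchingOf G M) (m : ℤ) (Γ : V → ℕ) : 0 ≤ excessAfter m Γ M := by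
  rw [← hM.totalExcess_balanceAlong_eq m Γ (w := fun e => e.out.1) fun e => Sym2.out_fst_mem e]
  exact_mod_cast totalExcess_nonneg m _

theorem excessAfter_le (m : ℤ) (Γ : V → ℕ) (M : Set (Sym2 V)) :
    excessAfter m Γ M ≤ totalExcess m Γ := by
  have : 0 ≤ ∑ v, ∑ u, (if s(v, u) ∈ M then (1 : ℝ) else 0) *
      ((excessDrop (Γ v - m) (Γ u - m) : ℝ) / 2) := by
    refine Finset.sum_nonneg fun v _ => Finset.sum_nonneg fun u _ => mul_nonneg ?_ ?_
    · split_ifs <;> norm_num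
    · have : (0 : ℝ) ≤ excessDrop (Γ v - m) (Γ u - m) := by exact_mod_cast excessDrop_nonneg _ _
      linarith
  rw [excessAfter]
  linarith

theorem IsMatchingOf.nextPotential_le {G : SimpleGraph V} {M : Set (Sym2 V)}
    (hM : IsMatchingOf G M) (m : ℤ) {S : ℕ} {Γ : V → ℕ} (hS : ∑ v, Γ v = S) (G' : SimpleGraph V) :
    nextPotential m S ⟨Γ, G', M⟩ ≤ ENNReal.ofReal (excessAfter m Γ M) := by
  refine PMF.eexpect_le_of_forall_le _ fun Γ' hΓ' => ?_
  obtain ⟨w, hw, rfl⟩ := mem_support_balanceStep hΓ'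
  rw [potential, if_pos ((hM.sum_balanceAlong Γ hw).trans hS),
    hM.totalExcess_balanceAlong_eq m Γ hw]

/-- The expected excess after a round in which every pair is matched with probability at least
`c`. -/
theorem expect_excessAfter_le (m : ℤ) (Γ : V → ℕ) (E : (Set (Sym2 V) → ℝ) → ℝ) {c : ℝ}
    (hE : E (excessAfter m Γ) = totalExcess m Γ - ∑ v, ∑ u,
      E (fun M => if s(v, u) ∈ M then 1 else 0) * ((excessDrop (Γ v - m) (Γ u - m) : ℝ) / 2))
    (hc0 : 0 ≤ c) (hc : ∀ v u, v ≠ u → c ≤ E fun M => if s(v, u) ∈ M then 1 else 0)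
    (hm : |2 * ∑ v, ((Γ v : ℤ) - m)| ≤ Fintype.card V) :
    E (excessAfter m Γ) ≤ (1 - c * Fintype.card V / 32) * totalExcess m Γ := by
  have h1 : c / 2 * ∑ v, ∑ u, (excessDrop (Γ v - m) (Γ u - m) : ℝ) ≤ ∑ v, ∑ u,
      E (fun M => if s(v, u) ∈ M then 1 else 0) *
        ((excessDrop (Γ v - m) (Γ u - m) : ℝ) / 2) := by
    simp only [Finset.mul_sum]
    refine Finset.sum_le_sum fun v _ => Finset.sum_le_sum fun u _ => ?_
    -- The diagonal has no matching probability to offer, but its drop is `0`.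
    rcases eq_or_ne v u with rfl | hne
    · have : excessDrop ((Γ v : ℤ) - m) (Γ v - m) = 0 := by
        have e1 : ((Γ v : ℤ) - m + (Γ v - m)) / 2 = Γ v - m := by omega
        have e2 : ((Γ v : ℤ) - m + (Γ v - m) + 1) / 2 = Γ v - m := by omega
        rw [excessDrop, e1, e2]; ring
      simp [this]
    · have h0 : (0 : ℝ) ≤ excessDrop (Γ v - m) (Γ u - m) := by
        exact_mod_cast excessDrop_nonneg _ _
      have := mul_le_mul_of_nonneg_right (hc v u hne) (div_nonneg h0 zero_le_two)
      linarith
  have h2 : (Fintype.card V : ℝ) * totalExcess m Γ ≤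
      16 * ∑ v, ∑ u, (excessDrop (Γ v - m) (Γ u - m) : ℝ) := by
    exact_mod_cast sum_excess_le (fun v => (Γ v : ℤ) - m) hm
  have h3 := mul_le_mul_of_nonneg_left h2 hc0
  rw [hE]
  linarith

/-- The rate of the decrease of the potential, in terms of the parameters of the graph. -/
theorem matching_rate_le {θ F p q : ℝ} {n : ℕ} (hθ : 0 < θ) (hF : 0 ≤ F) (hn : 0 < n) (hp : 0 < p)
    (hq1 : q < 1) (h : θ / n ≤ max p (1 - q)) :
    F / (1 / θ + 2) / (max p (1 - q) / min p (1 - q)) ≤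
      F * min p (1 - q) / (1 + 2 * n * max p (1 - q)) * n := by
  have hm : 0 < min p (1 - q) := lt_min hp (by linarith)
  have hM : 0 < max p (1 - q) := lt_max_of_lt_left hp
  set M := max p (1 - q)
  have hn' : (0 : ℝ) < n := by exact_mod_cast hn
  -- The lower bound on the density absorbs the `1` of the denominator into a multiple of `n * M`.
  have h1 : 1 ≤ n * M / θ := by
    rw [div_le_iff₀ hn'] at h
    rw [le_div_iff₀ hθ]; linarith
  calc F / (1 / θ + 2) / (M / min p (1 - q))
      = F * min p (1 - q) * n / (n * M / θ + 2 * n * M) := by field_simp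
    _ ≤ F * min p (1 - q) * n / (1 + 2 * n * M) := by gcongr
    _ = _ := by ring

theorem eexpect_nextPotential_le {D : SimpleGraph V → PMF (Set (Sym2 V))}
    (hD : ∀ G, ∀ M ∈ (D G).support, IsMatchingOf G M) {F : ℝ} (hF : 0 ≤ F)
    (hfair : ∀ (G : SimpleGraph V) (v u : V), G.Adj v u →
      F / (max (G.degree v) (G.degree u) : ℕ) ≤
        ((D G).toOuterMeasure {M | s(v, u) ∈ M}).toReal) {p q : ℝ} (hp : 0 < p) (hp1 : p ≤ 1) (hq : 0 ≤ q)
    (hq1 : q < 1) {m : ℤ} {S : ℕ} (hm : |2 * ((S : ℤ) - Fintype.card V * m)| ≤ Fintype.card V)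
    (Γ : V → ℕ) (G : SimpleGraph V) {ρ : ℝ}
    (hρ : ρ ≤ F * min p (1 - q) / (1 + 2 * Fintype.card V * max p (1 - q)) * Fintype.card V) :
    ((edgeMarkovStep p q G).eexpect fun G' =>
      (D G').eexpect fun M => nextPotential m S ⟨Γ, G', M⟩) ≤
    ENNReal.ofReal (Real.exp (-(ρ / 32))) * potential m S Γ := by
  -- Configurations with a wrong number of tokens occur in impossible histories; there the value `⊤`
  -- makes the bound trivial, and elsewhere `hm` gives the mean condition of `sum_excess_le`.
  by_cases hS : ∑ v, Γ v = S
  swap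
  · rw [potential, if_neg hS, ENNReal.mul_top]
    · exact le_top
    · simpa using Real.exp_pos _
  rw [potential, if_pos hS, ← ENNReal.ofReal_mul (Real.exp_pos _).le]
  have inner0 : ∀ G', 0 ≤ (D G').expect (excessAfter m Γ) := fun G' => by
    have := (D G').expect_mono (g := fun _ => 0) (h := excessAfter m Γ)
      fun M hM => (hD G' M hM).excessAfter_nonneg m Γ
    rwa [PMF.expect_const] at this
  refine ((edgeMarkovStep p q G).eexpect_le_ofReal
    (g := fun G' => (D G').expect (excessAfter m Γ))
    (fun G' _ => inner0 G') fun G' _ => (D G').eexpect_le_ofReal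
      (fun M hM => (hD G' M hM).excessAfter_nonneg m Γ)
      fun M hM => (hD G' M hM).nextPotential_le m hS G').trans ?_
  refine ENNReal.ofReal_le_ofReal ?_
  set c := F * min p (1 - q) / (1 + 2 * Fintype.card V * max p (1 - q)) with hc
  have hm0 : 0 < min p (1 - q) := lt_min hp (by linarith)
  have hM0 : 0 < max p (1 - q) := lt_max_of_lt_left hp
  have hc0 : 0 ≤ c := by positivity
  -- The functional averages first over the matching and then over the new graph. Since `Γ` is fixed
  -- here, the independence of the balancing and graph steps is already built in.
  have key := expect_excessAfter_le m Γ
    (fun g => (edgeMarkovStep p q G).expect fun G' => (D G').expect g) (c := c) ?_ hc0 ?_ ?_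
  · refine key.trans (mul_le_mul_of_nonneg_right ?_ (by exact_mod_cast totalExcess_nonneg m Γ))
    have := Real.add_one_le_exp (-(ρ / 32))
    linarith
  · unfold excessAfter
    simp only [PMF.expect_sub, PMF.expect_sum, PMF.expect_mul_const, PMF.expect_const]
  · intro v u hne
    refine le_expect_edgeMarkovStep hp hp1 hq hq1 hF G hne _ (fun G' => ?_) fun G' hadj => ?_
    · exact PMF.expect_nonneg _ fun M => by split_ifs <;> norm_num
    · exact (hfair G' v u hadj).trans_eq (PMF.toReal_toOuterMeasure _ _)
  · rw [Finset.sum_sub_distrib, ← Nat.cast_sum, hS]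
    simpa using hm

/-- The induction runs on `nextPotential`: the graph of a round is randomised before its matching is
drawn, so each new round contributes a factor. The initial graph is arbitrary and may have no edges,
so the first round only fails to increase the potential; hence exponent `t` at time `t + 1`. -/
theorem lintegral_potential_le {A : MatchingRule V} (hA : A.IsRandomMatching) {F : ℝ}
    (hF : 0 ≤ F) (hfair : A.IsFair F) {p q : ℝ} (hp : 0 < p) (hp1 : p ≤ 1) (hq : 0 ≤ q)
    (hq1 : q < 1) {m : ℤ} {S : ℕ} (hm : |2 * ((S : ℤ) - Fintype.card V * m)| ≤ Fintype.card V)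
    (G₀ : SimpleGraph V) {Γ₀ : V → ℕ} (hS : ∑ v, Γ₀ v = S) {ρ : ℝ}
    (hρ : ρ ≤ F * min p (1 - q) / (1 + 2 * Fintype.card V * max p (1 - q)) * Fintype.card V)
    (t : ℕ) :
    ∫⁻ ω, potential m S (ω (t + 1)).config ∂executionLaw A p q G₀ Γ₀ ≤
      ENNReal.ofReal (Real.exp (-(ρ / 32)) ^ t * totalExcess m Γ₀) := by
  have step : ∀ t, ∫⁻ ω, nextPotential m S (ω t) ∂executionLaw A p q G₀ Γ₀ ≤
      ENNReal.ofReal (Real.exp (-(ρ / 32)) ^ t * totalExcess m Γ₀) := fun t => by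
    induction t with
    | zero =>
      rw [lintegral_executionLaw_zero, firstRound, PMF.eexpect_map, pow_zero, one_mul]
      exact PMF.eexpect_le_of_forall_le _ fun M hM =>
        ((hA _ _ _ _ M hM).nextPotential_le m hS G₀).trans
          (ENNReal.ofReal_le_ofReal (excessAfter_le m Γ₀ M))
    | succ t ih =>
      refine (lintegral_executionLaw_succ_le A p q G₀ Γ₀ t (nextPotential m S)
        (fun R => ENNReal.ofReal (Real.exp (-(ρ / 32))) * nextPotential m S R) fun h => ?_).trans ?_
      · rw [nextRound, PMF.eexpect_bind]
        simp only [PMF.eexpect_bind, PMF.eexpect_map]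
        rw [nextPotential, ← PMF.eexpect_const_mul]
        exact PMF.eexpect_mono _ fun Γ _ =>
          eexpect_nextPotential_le (hA (t + 1) h Γ) hF (hfair (t + 1) h Γ) hp hp1 hq hq1 hm Γ _ hρ
      · rw [lintegral_const_mul' _ _ ENNReal.ofReal_ne_top, pow_succ', mul_assoc,
          ENNReal.ofReal_mul (Real.exp_pos _).le]
        gcongr
  refine (lintegral_executionLaw_succ_le A p q G₀ Γ₀ t (fun R => potential m S R.config)
    (nextPotential m S) fun h => ?_).trans (step t)
  rw [nextRound, PMF.eexpect_bind]
  simp only [PMF.eexpect_bind, PMF.eexpect_map, PMF.eexpect_const]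
  exact le_rfl

end Drift

/-! ### The balancing time -/

section BalancingTime

variable {V : Type*} [Fintype V]

/-- Rounding moves the average by at most `1 / 2`; this is the hypothesis of the drift estimate. -/
theorem abs_sum_sub_card_mul_nearestInt_le [Nonempty V] (Γ : V → ℕ) :
    |2 * (((∑ v, Γ v : ℕ) : ℤ) - Fintype.card V * nearestInt (averageLoad Γ))| ≤
      Fintype.card V := by
  have hn : (0 : ℝ) < Fintype.card V := by exact_mod_cast Fintype.card_pos
  have h1 : averageLoad Γ - 1 / 2 ≤ nearestInt (averageLoad Γ) := Int.le_ceil _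
  have h2 : (nearestInt (averageLoad Γ) : ℝ) < averageLoad Γ - 1 / 2 + 1 := Int.ceil_lt_add_one _
  have h3 : averageLoad Γ * Fintype.card V = ((∑ v, Γ v : ℕ) : ℝ) := by
    rw [averageLoad, div_mul_cancel₀ _ hn.ne', Nat.cast_sum]
  have h4 := mul_le_mul_of_nonneg_right h1 hn.le
  have h5 := mul_le_mul_of_nonneg_right h2.le hn.le
  have h6 : |2 * (((∑ v, Γ v : ℕ) : ℝ) - Fintype.card V * nearestInt (averageLoad Γ))| ≤
      Fintype.card V := by
    rw [← h3, abs_le]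
    constructor <;> nlinarith
  exact_mod_cast h6

theorem abs_sub_nearestInt_le [Nonempty V] (Γ : V → ℕ) (v : V) :
    |(Γ v : ℤ) - nearestInt (averageLoad Γ)| ≤ discrepancy Γ := by
  have hn : (0 : ℝ) < Fintype.card V := by exact_mod_cast Fintype.card_pos
  set a := Finset.univ.inf' Finset.univ_nonempty Γ with ha
  set b := Finset.univ.sup' Finset.univ_nonempty Γ with hb
  have hle : ∀ v, a ≤ Γ v := fun v => Finset.inf'_le _ (Finset.mem_univ v)
  have hge : ∀ v, Γ v ≤ b := fun v => Finset.le_sup' _ (Finset.mem_univ v)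
  have h1 : averageLoad Γ - 1 / 2 ≤ nearestInt (averageLoad Γ) := Int.le_ceil _
  have h2 : (nearestInt (averageLoad Γ) : ℝ) < averageLoad Γ - 1 / 2 + 1 := Int.ceil_lt_add_one _
  have h3 : (a : ℝ) ≤ averageLoad Γ := by
    rw [averageLoad, le_div_iff₀ hn]
    calc (a : ℝ) * Fintype.card V = ∑ _v : V, (a : ℝ) := by simp [mul_comm]
      _ ≤ _ := Finset.sum_le_sum fun v _ => by exact_mod_cast hle v
  have h4 : averageLoad Γ ≤ b := by
    rw [averageLoad, div_le_iff₀ hn]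
    calc ∑ v, (Γ v : ℝ) ≤ ∑ _v : V, (b : ℝ) :=
        Finset.sum_le_sum fun v _ => by exact_mod_cast hge v
      _ = _ := by simp [mul_comm]
  have h5 : (a : ℤ) < nearestInt (averageLoad Γ) + 1 := by
    exact_mod_cast (by linarith : (a : ℝ) < nearestInt (averageLoad Γ) + 1)
  have h6 : nearestInt (averageLoad Γ) < (b : ℤ) + 1 := by
    exact_mod_cast (by linarith : (nearestInt (averageLoad Γ) : ℝ) < b + 1)
  have h7 := hle v
  have h8 := hge v
  have h9 : discrepancy Γ = b - a := rfl
  rw [abs_le]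
  omega

theorem totalExcess_le [Nonempty V] (Γ : V → ℕ) :
    totalExcess (nearestInt (averageLoad Γ)) Γ ≤ Fintype.card V * (discrepancy Γ : ℤ) ^ 2 := by
  calc totalExcess (nearestInt (averageLoad Γ)) Γ ≤ ∑ _v : V, (discrepancy Γ : ℤ) ^ 2 :=
        Finset.sum_le_sum fun v _ => by
          have h := abs_sub_nearestInt_le Γ v
          have h1 := pow_le_pow_left₀ (abs_nonneg _) h 2
          rw [sq_abs] at h1
          rw [excess]
          linarith [abs_nonneg ((Γ v : ℤ) - nearestInt (averageLoad Γ))]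
    _ = _ := by simp

/-- A non-negative integer below `1` is `0`, and `excess` vanishes only on `{-1, 0, 1}`. -/
theorem isBalancedAround_of_potential_lt_one {m : ℤ} {S : ℕ} {Γ : V → ℕ}
    (h : potential m S Γ < 1) : IsBalancedAround m Γ := by
  have h0 : totalExcess m Γ = 0 := by
    rw [potential] at h
    split_ifs at h
    · rw [ENNReal.ofReal_lt_one] at h
      have h1 : totalExcess m Γ < 1 := by exact_mod_cast h
      have := totalExcess_nonneg m Γ
      omega
    · simp at h
  intro v
  have := (Finset.sum_eq_zero_iff_of_nonneg fun v _ => excess_nonneg ((Γ v : ℤ) - m)).1 h0 v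
    (Finset.mem_univ v)
  have := excess_eq_zero this
  omega

theorem balancingTime_le {ω : ℕ → Round V} {t : ℕ} {x : ℝ≥0∞} (ht : (t : ℝ≥0∞) ≤ x)
    (h : IsBalancedAround (nearestInt (averageLoad (ω 0).config)) (ω t).config) :
    (balancingTime ω : ℝ≥0∞) ≤ x := by
  refine le_trans ?_ ht
  have : balancingTime ω ≤ (t : ℕ∞) := sInf_le ⟨t, rfl, h⟩
  exact_mod_cast ENat.toENNReal_le.2 this

theorem executionLaw_config_zero_ne (A : MatchingRule V) (p q : ℝ) (G₀ : SimpleGraph V)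
    (Γ₀ : V → ℕ) : executionLaw A p q G₀ Γ₀ {ω | (ω 0).config ≠ Γ₀} = 0 := by
  have h1 : executionLaw A p q G₀ Γ₀ {ω | (ω 0).config ≠ Γ₀} =
      (executionLaw A p q G₀ Γ₀).map (fun ω => ω 0) {R | R.config ≠ Γ₀} := by
    rw [Measure.map_apply (by fun_prop) (Set.to_countable _).measurableSet]
    rfl
  rw [h1, map_executionLaw_zero,
    PMF.toMeasure_apply_eq_zero_iff _ (Set.to_countable _).measurableSet,
    Set.disjoint_left]
  intro R hR
  rw [firstRound, PMF.mem_support_map_iff] at hR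
  obtain ⟨M, -, rfl⟩ := hR
  simp

theorem le_executionLaw_of_potential {A : MatchingRule V} {p q : ℝ} {G₀ : SimpleGraph V}
    {Γ₀ : V → ℕ} {S t : ℕ} {ε : ℝ} {x : ℝ≥0∞} (hε : 0 ≤ ε) (ht : (t : ℝ≥0∞) ≤ x)
    (h : ∫⁻ ω, potential (nearestInt (averageLoad Γ₀)) S (ω t).config ∂executionLaw A p q G₀ Γ₀ ≤
      ENNReal.ofReal ε) :
    1 - ε ≤ (executionLaw A p q G₀ Γ₀).real {ω | (balancingTime ω : ℝ≥0∞) ≤ x} := by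
  set μ := executionLaw A p q G₀ Γ₀ with hμ
  set m := nearestInt (averageLoad Γ₀) with hm
  have hmeas : Measurable fun ω : ℕ → Round V => potential m S (ω t).config :=
    (measurable_of_countable fun R : Round V => potential m S R.config).comp (measurable_pi_apply t)
  have hbad : μ.real {ω | 1 ≤ potential m S (ω t).config} ≤ ε := by
    have := (mul_meas_ge_le_lintegral hmeas 1).trans h
    rw [one_mul] at this
    exact ENNReal.toReal_le_of_le_ofReal hε this
  -- `balancingTime` reads its target off the trajectory, which starts at `Γ₀` only almost surely.
  have hinit : μ.real {ω | (ω 0).config ≠ Γ₀} = 0 := by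
    rw [Measure.real, executionLaw_config_zero_ne, ENNReal.toReal_zero]
  have hcover : (Set.univ : Set (ℕ → Round V)) ⊆ {ω | (balancingTime ω : ℝ≥0∞) ≤ x} ∪
      ({ω | 1 ≤ potential m S (ω t).config} ∪ {ω | (ω 0).config ≠ Γ₀}) := by
    intro ω _
    by_cases h1 : 1 ≤ potential m S (ω t).config
    · exact Or.inr (Or.inl h1)
    by_cases h2 : (ω 0).config = Γ₀
    · refine Or.inl (balancingTime_le ht ?_)
      rw [h2]
      exact isBalancedAround_of_potential_lt_one (not_le.1 h1)
    · exact Or.inr (Or.inr h2)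
  have h1 : (1 : ℝ) ≤ μ.real ({ω | (balancingTime ω : ℝ≥0∞) ≤ x} ∪
      ({ω | 1 ≤ potential m S (ω t).config} ∪ {ω | (ω 0).config ≠ Γ₀})) := by
    rw [← probReal_univ (μ := μ)]
    exact measureReal_mono hcover
  have h2 := measureReal_union_le (μ := μ) {ω | (balancingTime ω : ℝ≥0∞) ≤ x}
    ({ω | 1 ≤ potential m S (ω t).config} ∪ {ω | (ω 0).config ≠ Γ₀})
  have h3 := measureReal_union_le (μ := μ) {ω | 1 ≤ potential m S (ω t).config}
    {ω | (ω 0).config ≠ Γ₀}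
  linarith

/-- A fair random matching algorithm balances within `O(r log (Δ n))` rounds, with high
probability. -/
theorem le_executionLaw_balancingTime [Nonempty V] {θ F a p q : ℝ} (hθ : 0 < θ) (hF : 0 < F)
    (ha : 0 < a) (hp : 0 < p) (hp1 : p ≤ 1) (hq : 0 ≤ q) (hq1 : q < 1)
    (hpq : θ / Fintype.card V ≤ max p (1 - q)) {A : MatchingRule V} (hA : A.IsRandomMatching)
    (hfair : A.IsFair F) (G₀ : SimpleGraph V) (Γ₀ : V → ℕ) :
    1 - (Fintype.card V : ℝ) ^ (-a) ≤
      (executionLaw A p q G₀ Γ₀).real {ω | (balancingTime ω : ℝ≥0∞) ≤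
        ENNReal.ofReal ((32 * (2 + a) / (F / (1 / θ + 2)) + 4) *
          (max p (1 - q) / min p (1 - q)) * Real.log (discrepancy Γ₀ * Fintype.card V))} := by
  have hn : (1 : ℝ) ≤ Fintype.card V := by exact_mod_cast Fintype.card_pos
  have hna : (0 : ℝ) ≤ (Fintype.card V : ℝ) ^ (-a) := by positivity
  have hm0 : 0 < min p (1 - q) := lt_min hp (by linarith)
  set r := max p (1 - q) / min p (1 - q) with hr
  have hr1 : 1 ≤ r := (one_le_div hm0).2 min_le_max
  set κ := F / (1 / θ + 2) with hκ
  have hκ0 : 0 < κ := by positivity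
  rcases Nat.eq_zero_or_pos (discrepancy Γ₀) with hΔ | hΔ
  -- Here `Real.log 0 = 0`, so the time bound is `0`; the initial potential already vanishes.
  · refine le_executionLaw_of_potential (S := ∑ v, Γ₀ v) (t := 0) hna (by simp) ?_
    rw [lintegral_executionLaw_zero A p q G₀ Γ₀ fun R =>
      potential (nearestInt (averageLoad Γ₀)) (∑ v, Γ₀ v) R.config, firstRound, PMF.eexpect_map]
    refine PMF.eexpect_le_of_forall_le _ fun M _ => ?_
    have h := totalExcess_le Γ₀
    rw [hΔ] at h
    have h0 : totalExcess (nearestInt (averageLoad Γ₀)) Γ₀ = 0 :=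
      le_antisymm (by simpa using h) (totalExcess_nonneg _ _)
    simp [potential, h0]
  have hn2 : 2 ≤ Fintype.card V := by
    by_contra hlt
    have : Fintype.card V = 1 := by have := Fintype.card_pos (α := V); omega
    obtain ⟨v, hv⟩ := Fintype.card_eq_one_iff.1 this
    have : discrepancy Γ₀ = 0 := by
      have : Γ₀ = fun _ => Γ₀ v := funext fun w => by rw [hv w]
      rw [discrepancy, this]
      simp
    omega
  have hΨ : (totalExcess (nearestInt (averageLoad Γ₀)) Γ₀ : ℝ) ≤
      (Fintype.card V : ℝ) * (discrepancy Γ₀ : ℝ) ^ 2 := by exact_mod_cast totalExcess_le Γ₀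
  set Δ : ℝ := (discrepancy Γ₀ : ℝ) with hΔdef
  have hΔ1 : (1 : ℝ) ≤ Δ := Nat.one_le_cast.2 hΔ
  set n : ℝ := (Fintype.card V : ℝ) with hndef
  have hn2' : (2 : ℝ) ≤ n := Nat.ofNat_le_cast.2 hn2
  have hnΔ : n ≤ Δ * n := by nlinarith
  set L := Real.log (Δ * n) with hL
  have hL0 : 1 / 2 ≤ L := by
    have h1 : Real.log 2 ≤ L := Real.log_le_log (by norm_num) (by linarith)
    linarith [Real.log_two_gt_d9]
  have hexpL : Real.exp L = Δ * n := Real.exp_log (by linarith)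
  -- Chosen so that `y` rounds at rate `κ / r / 32` give `exp (-(2 + a) * L)`: the part `2 * L`
  -- cancels the initial potential, at most `(Δ * n) ^ 2`, and `a * L` leaves `(Δ * n) ^ (-a)`.
  set y := 32 * (2 + a) / κ * r * L with hy
  have hy0 : 0 ≤ y := by positivity
  refine le_executionLaw_of_potential (t := ⌈y⌉₊ + 1) hna ?_
    ((lintegral_potential_le hA hF.le hfair hp hp1 hq hq1 (abs_sum_sub_card_mul_nearestInt_le Γ₀)
      G₀ rfl (matching_rate_le hθ hF.le Fintype.card_pos hp hq1 hpq) ⌈y⌉₊).trans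
      (ENNReal.ofReal_le_ofReal ?_))
  -- The summand `4` of the constant pays for the ceiling and the idle first round, as `4 * r * L ≥
  -- 2`.
  · rw [← ENNReal.ofReal_natCast]
    refine ENNReal.ofReal_le_ofReal ?_
    have h1 := Nat.ceil_lt_add_one hy0
    have h2 : 1 / 2 ≤ r * L := by nlinarith
    push_cast
    rw [add_mul, add_mul]
    linarith
  · have h2 : n * Δ ^ 2 ≤ Real.exp (2 * L) := by
      rw [two_mul, Real.exp_add, hexpL]
      nlinarith [mul_nonneg (sq_nonneg Δ) (by nlinarith : (0:ℝ) ≤ n * n - n)]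
    have h3 : Real.exp (-(κ / r / 32)) ^ ⌈y⌉₊ ≤ Real.exp (-((2 + a) * L)) := by
      rw [← Real.exp_nat_mul]
      refine Real.exp_le_exp.2 ?_
      have h4 : y * (κ / r / 32) = (2 + a) * L := by
        rw [hy]
        field_simp
      have h5 : y * (κ / r / 32) ≤ ⌈y⌉₊ * (κ / r / 32) :=
        mul_le_mul_of_nonneg_right (Nat.le_ceil y) (by positivity)
      linarith
    calc Real.exp (-(κ / r / 32)) ^ ⌈y⌉₊ * totalExcess (nearestInt (averageLoad Γ₀)) Γ₀
        ≤ Real.exp (-((2 + a) * L)) * Real.exp (2 * L) :=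
          mul_le_mul h3 (hΨ.trans h2) (by exact_mod_cast totalExcess_nonneg _ _) (Real.exp_pos _).le
      _ = Real.exp (L * (-a)) := by rw [← Real.exp_add]; ring_nf
      _ = (Δ * n) ^ (-a) := by rw [Real.exp_mul, hexpL]
      _ ≤ n ^ (-a) := Real.rpow_le_rpow_of_nonpos (by linarith) hnΔ (by linarith)

end BalancingTime

/-! ### The local randomized matching -/

section LR

variable {V : Type*} [Fintype V]

theorem eq_of_mem_pruneOut {E : Set (V × V)} {v u u' : V} (h : (v, u) ∈ pruneOut E)
    (h' : (v, u') ∈ pruneOut E) : u = u' := by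
  have h1 : {u | (v, u) ∈ E}.ncard ≤ 1 := not_lt.1 h.2
  exact (Set.ncard_le_one_iff (Set.toFinite _)).1 h1 h.1 h'.1

theorem eq_of_mem_pruneIn {E : Set (V × V)} {v u u' : V} (h : (u, v) ∈ pruneIn E)
    (h' : (u', v) ∈ pruneIn E) : u = u' := by
  have h1 : {u | (u, v) ∈ E}.ncard ≤ 1 := not_lt.1 h.2
  exact (Set.ncard_le_one_iff (Set.toFinite _)).1 h1 h.1 h'.1

theorem inDeg_eq_zero {E : Set (V × V)} {v : V} : inDeg E v = 0 ↔ ∀ u, (u, v) ∉ E := by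
  rw [inDeg, Set.ncard_eq_zero (Set.toFinite _), Set.eq_empty_iff_forall_notMem]
  rfl

/-- Both output clauses merge into one condition: a pair entering the tail forces the reverse pair.
With unique in- and out-neighbours this excludes two output edges at one vertex. -/
theorem mem_lrOutput {E : Set (V × V)} {e : Sym2 V} (h : e ∈ lrOutput E) :
    ∃ v u, e = s(v, u) ∧ (v, u) ∈ E ∧ ∀ w, (w, v) ∈ E → (u, v) ∈ E := by
  rcases h with ⟨v, u, rfl, h1, h2⟩ | ⟨v, u, rfl, h1, h2⟩
  · exact ⟨v, u, rfl, h1, fun w hw => absurd hw (inDeg_eq_zero.1 h2 w)⟩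
  · exact ⟨v, u, rfl, h1, fun _ _ => h2⟩

theorem isMatchingOf_lrOutput {G : SimpleGraph V} {E : Set (V × V)}
    (hE : ∀ v u, (v, u) ∈ E → G.Adj v u) : IsMatchingOf G (lrOutput (pruneIn (pruneOut E))) := by
  set R := pruneIn (pruneOut E) with hR
  have hout : ∀ {v u u'}, (v, u) ∈ R → (v, u') ∈ R → u = u' := fun h h' =>
    eq_of_mem_pruneOut h.1 h'.1
  have hin : ∀ {v u u'}, (u, v) ∈ R → (u', v) ∈ R → u = u' := fun h h' => eq_of_mem_pruneIn h h'
  refine ⟨fun e he => ?_, fun e he f hf hne w hw => ?_⟩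
  · obtain ⟨v, u, rfl, h, -⟩ := mem_lrOutput he
    exact hE v u h.1.1
  · obtain ⟨a, b, rfl, h1, h2⟩ := mem_lrOutput he
    obtain ⟨c, d, rfl, h3, h4⟩ := mem_lrOutput hf
    refine hne ?_
    rcases Sym2.mem_iff.1 hw.1 with e1 | e1 <;> rcases Sym2.mem_iff.1 hw.2 with e2 | e2 <;>
      subst e1 <;> subst e2
    · rw [hout h1 h3]
    · rw [hin (h2 _ h3) h3, Sym2.eq_swap]
    · rw [hin (h4 _ h1) h1, Sym2.eq_swap]
    · rw [hin h1 h3]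

theorem mem_lrOutput_of_isolated {E : Set (V × V)} {v u : V} (h : (v, u) ∈ E)
    (hout : ∀ w, w ≠ u → (v, w) ∉ E) (hin : ∀ w, w ≠ v → (w, u) ∉ E) (hv : ∀ w, (w, v) ∉ E) :
    s(v, u) ∈ lrOutput (pruneIn (pruneOut E)) := by
  refine Or.inl ⟨v, u, rfl, ⟨⟨h, not_lt.2 ?_⟩, not_lt.2 ?_⟩,
    inDeg_eq_zero.2 fun w hw => hv w hw.1.1⟩
  · refine (Set.ncard_le_one_iff (Set.toFinite _)).2 fun {a b} ha hb => ?_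
    rw [not_imp_not.1 (hout a) ha, not_imp_not.1 (hout b) hb]
  · refine (Set.ncard_le_one_iff (Set.toFinite _)).2 fun {a b} ha hb => ?_
    rw [not_imp_not.1 (hin a) ha.1, not_imp_not.1 (hin b) hb.1]

/-- Summing `1 / (k max {deg v, deg w})` over the neighbours `w` of `v` gives at most `1 / k`. -/
theorem sum_inv_max_degree_le (G : SimpleGraph V) (v : V) {k : ℝ} (hk : 0 < k) (s : Finset V) :
    ∑ w ∈ s, (if G.Adj v w then 1 / (k * (max (G.degree v) (G.degree w) : ℕ)) else 0) ≤
      1 / k := by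
  have hnn : ∀ w, (0 : ℝ) ≤ if G.Adj v w then 1 / (k * (max (G.degree v) (G.degree w) : ℕ)) else 0 :=
    fun w => by split_ifs <;> positivity
  calc ∑ w ∈ s, (if G.Adj v w then 1 / (k * (max (G.degree v) (G.degree w) : ℕ)) else 0)
      ≤ ∑ w, (if G.Adj v w then 1 / (k * (max (G.degree v) (G.degree w) : ℕ)) else 0) :=
        Finset.sum_le_sum_of_subset_of_nonneg (Finset.subset_univ s) fun w _ _ => hnn w
    _ ≤ ∑ w, (if G.Adj v w then 1 / (k * G.degree v) else 0) := by
        refine Finset.sum_le_sum fun w _ => ?_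
        split_ifs with h
        · have hd : 0 < G.degree v := (G.degree_pos_iff_exists_adj v).2 ⟨w, h⟩
          have hd' : (0 : ℝ) < G.degree v := by exact_mod_cast hd
          have : (G.degree v : ℝ) ≤ (max (G.degree v) (G.degree w) : ℕ) := by
            exact_mod_cast le_max_left _ _
          gcongr
        · exact le_rfl
    _ = G.degree v * (1 / (k * G.degree v)) := by
        rw [← Finset.sum_filter, Finset.sum_const, nsmul_eq_mul,
          ← SimpleGraph.neighborFinset_eq_filter, SimpleGraph.card_neighborFinset_eq_degree]
    _ ≤ 1 / k := by
        rcases Nat.eq_zero_or_pos (G.degree v) with h | h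
        · rw [h]; simp [hk.le]
        · have : (0 : ℝ) < G.degree v := by exact_mod_cast h
          rw [← one_div_mul_one_div]
          field_simp
          exact le_rfl

theorem isRandomMatching_lrMatching :
    (MatchingRule.ofStatic (lrMatching (V := V))).IsRandomMatching := by
  intro t past Γ G M hM
  change M ∈ (lrMatching G).support at hM
  rw [lrMatching, PMF.mem_support_map_iff] at hM
  obtain ⟨x, hx, rfl⟩ := hM
  refine isMatchingOf_lrOutput fun v u hvu => ?_
  by_contra hadj
  have h := mem_support_independentFamily hx (v, u)
  rw [if_neg hadj] at h
  have h' : x (v, u) = true := hvu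
  rw [coin_zero_support h] at h'
  exact Bool.false_ne_true h'

theorem isFair_lrMatching : (MatchingRule.ofStatic (lrMatching (V := V))).IsFair (1 / 8) := by
  intro t past Γ G v u hadj
  change _ ≤ ((lrMatching G).toOuterMeasure {M | s(v, u) ∈ M}).toReal
  rw [PMF.toReal_toOuterMeasure, lrMatching, PMF.expect_map]
  set χ : Bool → ℝ := fun b => if b = true then 1 else 0 with hχ
  have hχ0 : ∀ b, 0 ≤ χ b := fun b => by simp only [hχ]; split_ifs <;> norm_num
  set π : V × V → ℝ := fun e =>
    if G.Adj e.1 e.2 then 1 / (8 * (max (G.degree e.1) (G.degree e.2) : ℕ)) else 0 with hπ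
  have hπ0 : ∀ e, 0 ≤ π e := fun e => by simp only [hπ]; split_ifs <;> positivity
  have hπ1 : ∀ e, π e ≤ 1 := fun e => by
    have h := sum_inv_max_degree_le G e.1 (k := 8) (by norm_num) {e.2}
    rw [Finset.sum_singleton] at h
    simp only [hπ]
    linarith
  have hc : ∀ e, (coin (π e)).expect χ = π e := fun e => by
    rw [expect_coin (hπ0 e) (hπ1 e)]; simp [hχ]
  have hsymm : ∀ a b, π (a, b) = π (b, a) := fun a b => by
    simp only [hπ, G.adj_comm a b, max_comm (G.degree a)]
  have hrow : ∀ (a : V) (s : Finset V), ∑ w ∈ s, π (a, w) ≤ 1 / 8 := fun a s =>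
    sum_inv_max_degree_le G a (by norm_num) s
  have hcol : ∀ (a : V) (s : Finset V), ∑ w ∈ s, π (w, a) ≤ 1 / 8 := fun a s => by
    simpa only [hsymm _ a] using hrow a s
  -- A union bound for the event of `mem_lrOutput_of_isolated`. Each of the three sums of
  -- competitors has mean at most `1 / 8`, which leaves `5 / 8` of `π (v, u)`; the two orientations
  -- together exceed `π (v, u)`.
  set g : V → V → (V × V → Bool) → ℝ := fun v u x => χ (x (v, u)) -
    ∑ w ∈ Finset.univ.erase u, χ (x (v, u)) * χ (x (v, w)) -
    ∑ w ∈ Finset.univ.erase v, χ (x (v, u)) * χ (x (w, u)) -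
    ∑ w, χ (x (v, u)) * χ (x (w, v)) with hg
  have hg' : ∀ v u x, g v u x = χ (x (v, u)) * (1 - ∑ w ∈ Finset.univ.erase u, χ (x (v, w)) -
      ∑ w ∈ Finset.univ.erase v, χ (x (w, u)) - ∑ w, χ (x (w, v))) := fun v u x => by
    simp only [hg, ← Finset.mul_sum]
    ring
  have hEg : ∀ v u, v ≠ u → 5 / 8 * π (v, u) ≤
      (independentFamily fun e => coin (π e)).expect (g v u) := fun v u hne => by
    have h2 : ∀ e f, e ≠ f → (independentFamily fun e => coin (π e)).expect
        (fun x => χ (x e) * χ (x f)) = π e * π f := fun e f hef => by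
      rw [expect_independentFamily_two (fun e => coin (π e)) hef χ χ, hc, hc]
    have e1 : (independentFamily fun e => coin (π e)).expect (g v u) =
        π (v, u) - ∑ w ∈ Finset.univ.erase u, π (v, u) * π (v, w) -
        ∑ w ∈ Finset.univ.erase v, π (v, u) * π (w, u) - ∑ w, π (v, u) * π (w, v) := by
      simp only [hg, PMF.expect_sub, PMF.expect_sum]
      rw [expect_independentFamily_one (fun e => coin (π e)) (v, u) χ, hc]
      congr 1
      · congr 1
        · congr 1
          refine Finset.sum_congr rfl fun w hw => h2 _ _ fun h => ?_
          exact (Finset.mem_erase.1 hw).1 (Prod.ext_iff.1 h).2.symm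
        · refine Finset.sum_congr rfl fun w hw => h2 _ _ fun h => ?_
          exact (Finset.mem_erase.1 hw).1 (Prod.ext_iff.1 h).1.symm
      · exact Finset.sum_congr rfl fun w _ => h2 _ _ fun h => hne (Prod.ext_iff.1 h).2.symm
    rw [e1, ← Finset.mul_sum, ← Finset.mul_sum, ← Finset.mul_sum]
    have b1 := mul_le_mul_of_nonneg_left (hrow v (Finset.univ.erase u)) (hπ0 (v, u))
    have b2 := mul_le_mul_of_nonneg_left (hcol u (Finset.univ.erase v)) (hπ0 (v, u))
    have b3 := mul_le_mul_of_nonneg_left (hcol v Finset.univ) (hπ0 (v, u))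
    linarith
  have hgle : ∀ v u x, g v u x ≤
      if s(v, u) ∈ lrOutput (pruneIn (pruneOut {e | x e = true})) then 1 else 0 := fun v u x => by
    have n1 := Finset.sum_nonneg fun w (_ : w ∈ Finset.univ.erase u) => hχ0 (x (v, w))
    have n2 := Finset.sum_nonneg fun w (_ : w ∈ Finset.univ.erase v) => hχ0 (x (w, u))
    have n3 := Finset.sum_nonneg fun w (_ : w ∈ Finset.univ) => hχ0 (x (w, v))
    by_cases hx : x (v, u) = true
    swap
    · have hxv : χ (x (v, u)) = 0 := by simp [hχ, hx]
      rw [hg', hxv, zero_mul]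
      split_ifs <;> norm_num
    have hxv : χ (x (v, u)) = 1 := by simp [hχ, hx]
    rw [hg', hxv, one_mul]
    split_ifs with hmem
    · linarith
    by_contra hlt
    have int : ∀ s : Finset V, ∀ f : V → V × V, ∑ w ∈ s, χ (x (f w)) < 1 →
        ∀ w ∈ s, x (f w) = false := fun s f hs w hw => by
      by_contra hne
      have h1 : χ (x (f w)) = 1 := by simp only [hχ]; rw [if_pos (by simpa using hne)]
      have := Finset.single_le_sum (fun i _ => hχ0 (x (f i))) hw
      linarith
    refine hmem (mem_lrOutput_of_isolated hx (fun w hw h => ?_) (fun w hw h => ?_) fun w h => ?_)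
    · have := int (Finset.univ.erase u) (fun w => (v, w)) (by linarith) w (by simp [hw])
      exact Bool.false_ne_true (this.symm.trans h)
    · have := int (Finset.univ.erase v) (fun w => (w, u)) (by linarith) w (by simp [hw])
      exact Bool.false_ne_true (this.symm.trans h)
    · have := int Finset.univ (fun w => (w, v)) (by linarith) w (by simp)
      exact Bool.false_ne_true (this.symm.trans h)
  -- The last sum of `g` includes `w = u`, so the two orientations cannot both contribute and their
  -- sum stays below one indicator.
  have hboth : ∀ v u x, x (u, v) = true → g v u x ≤ 0 := fun v u x hx => by
    have n1 := Finset.sum_nonneg fun w (_ : w ∈ Finset.univ.erase u) => hχ0 (x (v, w))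
    have n2 := Finset.sum_nonneg fun w (_ : w ∈ Finset.univ.erase v) => hχ0 (x (w, u))
    have n3 := Finset.single_le_sum (fun w _ => hχ0 (x (w, v))) (Finset.mem_univ u)
    have h1 : χ (x (u, v)) = 1 := by simp [hχ, hx]
    rw [hg']
    exact mul_nonpos_of_nonneg_of_nonpos (hχ0 _) (by linarith)
  have hne : v ≠ u := G.ne_of_adj hadj
  calc 1 / 8 / ((max (G.degree v) (G.degree u) : ℕ) : ℝ) = π (v, u) := by
        simp only [hπ, if_pos hadj]
        rw [div_div]
    _ ≤ 5 / 8 * π (v, u) + 5 / 8 * π (u, v) := by rw [hsymm u v]; linarith [hπ0 (v, u)]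
    _ ≤ _ := add_le_add (hEg v u hne) (hEg u v hne.symm)
    _ = (independentFamily fun e => coin (π e)).expect fun x => g v u x + g u v x :=
        (PMF.expect_add _ _ _).symm
    _ ≤ _ := PMF.expect_mono _ fun x _ => ?_
  have h1 := hgle v u x
  have h2 := hgle u v x
  rw [Sym2.eq_swap (a := u)] at h2
  by_cases hx : x (u, v) = true
  · have := hboth v u x hx
    exact (by linarith : _ ≤ _).trans h2
  · have : g u v x = 0 := by rw [hg']; simp [hχ, hx]
    rw [this, add_zero]
    exact h1

end LR

/-! ### The localized distributed synchronous matching -/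

section DS

variable {V : Type*} [Fintype V]

theorem mem_support_dsChoice {G : SimpleGraph V} {v u : V} {b : Bool}
    (h : (b, some u) ∈ (dsChoice G v).support) : b = true ∧ G.Adj v u := by
  rw [dsChoice, PMF.mem_support_bind_iff] at h
  obtain ⟨inI, -, h⟩ := h
  split_ifs at h with hI
  · rw [PMF.mem_support_bind_iff] at h
    obtain ⟨w, hw, h⟩ := h
    rw [PMF.mem_support_map_iff] at h
    obtain ⟨c, -, h⟩ := h
    obtain ⟨rfl, h2⟩ := Prod.ext_iff.1 h
    refine ⟨hI.1, ?_⟩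
    have hw' := (PMF.mem_support_uniformOfFinset_iff _ _).1 hw
    cases c
    · simp at h2
    · simp only [if_true, Option.some.injEq] at h2
      rwa [← h2, ← SimpleGraph.mem_neighborFinset]
  · simp at h

theorem dsChoice_false_expect (G : SimpleGraph V) (v : V) :
    (dsChoice G v).expect (fun y => if y.1 = false then 1 else 0) = 1 / 2 := by
  rw [dsChoice, PMF.expect_bind, expect_coin (by norm_num) (by norm_num)]
  have h1 : ∀ h : (G.neighborFinset v).Nonempty,
      ((PMF.uniformOfFinset (G.neighborFinset v) h).bind fun u =>
        (coin ((min (G.degree u) (G.degree v) : ℕ) / (G.degree u : ℝ))).map fun accept =>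
          (true, if accept then some u else none)).expect
        (fun y : Bool × Option V => if y.1 = false then (1 : ℝ) else 0) = 0 := fun h => by
    rw [PMF.expect_bind]
    simp only [PMF.expect_map]
    simp [PMF.expect]
  by_cases h : (G.neighborFinset v).Nonempty
  · simp only [h, and_true, dif_pos, h1 h]
    simp [PMF.expect_pure]
    norm_num
  · simp [h, PMF.expect_pure]
    norm_num

/-- The acceptance probability makes the link law symmetric: `1 / 2 * (1 / deg v) * (min / deg u)`,
with `min * max = deg u * deg v`. -/
theorem dsChoice_some_expect (G : SimpleGraph V) (v u : V) :
    (dsChoice G v).expect (fun y => if y.2 = some u then 1 else 0) =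
      if G.Adj v u then 1 / (2 * ((max (G.degree v) (G.degree u) : ℕ) : ℝ)) else 0 := by
  split_ifs with hadj
  · have hne : (G.neighborFinset v).Nonempty := ⟨u, by simpa using hadj⟩
    have hv : (0 : ℝ) < G.degree v := by
      exact_mod_cast (G.degree_pos_iff_exists_adj v).2 ⟨u, hadj⟩
    have hu : (0 : ℝ) < G.degree u := by
      exact_mod_cast (G.degree_pos_iff_exists_adj u).2 ⟨v, hadj.symm⟩
    have h1 : ∀ w, (coin ((min (G.degree w) (G.degree v) : ℕ) / (G.degree w : ℝ))).expect
        (fun accept => if (if accept = true then some w else none) = some u then (1 : ℝ) else 0) =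
        if w = u then (min (G.degree u) (G.degree v) : ℕ) / (G.degree u : ℝ) else 0 := fun w => by
      rw [expect_coin (by positivity) (div_le_one_of_le₀ (by exact_mod_cast min_le_left _ _)
        (by positivity))]
      by_cases hw : w = u
      · subst hw; simp
      · simp [hw]
    rw [dsChoice, PMF.expect_bind, expect_coin (by norm_num) (by norm_num)]
    simp only [hne, and_true, dif_pos, PMF.expect_bind, PMF.expect_map, h1,
      PMF.expect_uniformOfFinset]
    rw [Finset.sum_ite_eq', if_pos (by simpa using hadj),
      SimpleGraph.card_neighborFinset_eq_degree]
    simp only [Bool.false_eq_true, dif_neg, not_false_eq_true, PMF.expect_pure, reduceCtorEq,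
      if_false, mul_zero, add_zero]
    have hmm : ((min (G.degree u) (G.degree v) : ℕ) : ℝ) * (max (G.degree v) (G.degree u) : ℕ) =
        G.degree u * G.degree v := by
      rw [max_comm]; exact_mod_cast min_mul_max _ _
    have hmax : (0 : ℝ) < (max (G.degree v) (G.degree u) : ℕ) := by
      rw [Nat.cast_max]; exact lt_max_of_lt_left hv
    field_simp
    linarith
  · refine Finset.sum_eq_zero fun y _ => ?_
    by_cases hy : y ∈ (dsChoice G v).support
    · refine mul_eq_zero_of_right _ (if_neg fun h => hadj ?_)
      obtain ⟨b, o⟩ := y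
      obtain rfl : o = some u := h
      exact (mem_support_dsChoice hy).2
    · rw [PMF.mem_support_iff, not_not] at hy
      simp [hy]

theorem isRandomMatching_dsMatching :
    (MatchingRule.ofStatic (dsMatching (V := V))).IsRandomMatching := by
  intro t past Γ G M hM
  change M ∈ (dsMatching G).support at hM
  rw [dsMatching, PMF.mem_support_map_iff] at hM
  obtain ⟨x, hx, rfl⟩ := hM
  have hlink : ∀ {v u}, (v, u) ∈ dsLinks x → (x v).1 = true ∧ G.Adj v u := fun {v u} h => by
    have h1 := mem_support_independentFamily hx v
    have h2 : x v = ((x v).1, some u) := Prod.ext rfl h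
    rw [h2] at h1
    exact mem_support_dsChoice h1
  have hout : ∀ {v u u'}, (v, u) ∈ dsLinks x → (v, u') ∈ dsLinks x → u = u' := fun h h' =>
    Option.some_injective _ (Eq.trans (Eq.symm h) h')
  have hin : ∀ {v u u'}, inDeg (dsLinks x) v = 1 → (u, v) ∈ dsLinks x → (u', v) ∈ dsLinks x →
      u = u' := fun {v u u'} hd h h' =>
    (Set.ncard_le_one_iff (Set.toFinite _)).1 hd.le h h'
  refine ⟨?_, ?_⟩
  · rintro _ ⟨v, u, rfl, h, -⟩
    exact (hlink h).2
  · rintro _ ⟨a, b, rfl, h1, h2, h3⟩ _ ⟨c, d, rfl, h4, h5, h6⟩ hne w ⟨hw1, hw2⟩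
    refine hne ?_
    rcases Sym2.mem_iff.1 hw1 with e1 | e1 <;> rcases Sym2.mem_iff.1 hw2 with e2 | e2 <;>
      subst e1 <;> subst e2
    · rw [hout h1 h4]
    · exact absurd ((hlink h1).1.symm.trans h5) (by simp)
    · exact absurd ((hlink h4).1.symm.trans h2) (by simp)
    · rw [hin h3 h1 h4]

theorem isFair_dsMatching : (MatchingRule.ofStatic (dsMatching (V := V))).IsFair (1 / 4) := by
  intro t past Γ G v u hadj
  change _ ≤ ((dsMatching G).toOuterMeasure {M | s(v, u) ∈ M}).toReal
  rw [PMF.toReal_toOuterMeasure, dsMatching, PMF.expect_map]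
  set P := independentFamily fun v : V => dsChoice G v with hP
  set χ : V → Bool × Option V → ℝ := fun u y => if y.2 = some u then 1 else 0 with hχ
  set ψ : Bool × Option V → ℝ := fun y => if y.1 = false then 1 else 0 with hψ
  set π : V → V → ℝ := fun v u =>
    if G.Adj v u then 1 / (2 * ((max (G.degree v) (G.degree u) : ℕ) : ℝ)) else 0 with hπ
  have hχ0 : ∀ u y, 0 ≤ χ u y := fun u y => by simp only [hχ]; split_ifs <;> norm_num
  have hπ0 : ∀ v u, 0 ≤ π v u := fun v u => by simp only [hπ]; split_ifs <;> positivity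
  have hEχ : ∀ v u, (dsChoice G v).expect (χ u) = π v u := dsChoice_some_expect G
  have hEψ : ∀ v, (dsChoice G v).expect ψ = 1 / 2 := dsChoice_false_expect G
  have hsymm : ∀ a b, π a b = π b a := fun a b => by
    simp only [hπ, G.adj_comm a b, max_comm (G.degree a)]
  -- A union bound over competing links into `u`. Excluding `w = u` and `w = v` keeps the three
  -- choices independent. The competitors have total mean at most `1 / 2` and `u ∉ I` costs another
  -- `1 / 2`, so each orientation gives `π v u / 4`.
  set g : V → V → (V → Bool × Option V) → ℝ := fun v u x => χ u (x v) * ψ (x u) -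
    ∑ w ∈ (Finset.univ.erase v).erase u, χ u (x v) * ψ (x u) * χ u (x w) with hg
  have hg' : ∀ v u x, g v u x = χ u (x v) * ψ (x u) *
      (1 - ∑ w ∈ (Finset.univ.erase v).erase u, χ u (x w)) := fun v u x => by
    simp only [hg, ← Finset.mul_sum]
    ring
  have hEg : ∀ v u, v ≠ u → π v u / 4 ≤ P.expect (g v u) := fun v u hne => by
    have e1 : P.expect (g v u) = π v u * (1 / 2) -
        ∑ w ∈ (Finset.univ.erase v).erase u, π v u * (1 / 2) * π w u := by
      simp only [hg, PMF.expect_sub, PMF.expect_sum]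
      rw [hP, expect_independentFamily_two (fun v => dsChoice G v) hne (χ u) ψ, hEχ, hEψ]
      congr 1
      refine Finset.sum_congr rfl fun w hw => ?_
      simp only [Finset.mem_erase, Finset.mem_univ, and_true] at hw
      rw [expect_independentFamily_three (fun v => dsChoice G v) hne hw.2.symm hw.1.symm
        (χ u) ψ (χ u), hEχ, hEψ, hEχ]
    have e2 : ∑ w ∈ (Finset.univ.erase v).erase u, π w u ≤ 1 / 2 := by
      simp only [hsymm _ u]
      exact sum_inv_max_degree_le G u (by norm_num) _
    rw [e1, ← Finset.mul_sum]
    have := mul_le_mul_of_nonneg_left e2 (hπ0 v u)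
    linarith
  have hgle : ∀ v u, v ≠ u → ∀ x ∈ P.support, g v u x ≤
      if s(v, u) ∈ {e | ∃ v u, e = s(v, u) ∧ (v, u) ∈ dsLinks x ∧ (x u).1 = false ∧
        inDeg (dsLinks x) u = 1} then 1 else 0 := fun v u hne x hx => by
    have n1 := Finset.sum_nonneg fun w (_ : w ∈ (Finset.univ.erase v).erase u) => hχ0 u (x w)
    by_cases h1 : (x v).2 = some u
    swap
    · have : χ u (x v) = 0 := by simp [hχ, h1]
      rw [hg', this, zero_mul, zero_mul]
      split_ifs <;> norm_num
    by_cases h2 : (x u).1 = false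
    swap
    · have : ψ (x u) = 0 := by simp [hψ, h2]
      rw [hg', this, mul_zero, zero_mul]
      split_ifs <;> norm_num
    have e1 : χ u (x v) = 1 := by simp [hχ, h1]
    have e2 : ψ (x u) = 1 := by simp [hψ, h2]
    rw [hg', e1, e2, one_mul, one_mul]
    split_ifs with hmem
    · linarith
    by_contra hlt
    refine hmem ⟨v, u, rfl, h1, h2, ?_⟩
    rw [inDeg, Set.ncard_eq_one]
    refine ⟨v, Set.Subset.antisymm (fun w hw => ?_) (Set.singleton_subset_iff.2 h1)⟩
    have hw' : (x w).2 = some u := hw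
    by_contra hwv
    -- The index `u` left out of the sum is harmless: a vertex outside `I` makes no link.
    have hwu : w ≠ u := by
      rintro rfl
      have h3 := mem_support_independentFamily hx w
      rw [show x w = ((x w).1, some w) from Prod.ext rfl hw'] at h3
      exact Bool.false_ne_true (h2.symm.trans (mem_support_dsChoice h3).1)
    have h4 : χ u (x w) = 1 := by simp [hχ, hw']
    have h5 := Finset.single_le_sum (s := (Finset.univ.erase v).erase u)
      (fun i _ => hχ0 u (x i)) (show w ∈ _ by simpa using ⟨hwu, hwv⟩)
    linarith
  have hne : v ≠ u := G.ne_of_adj hadj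
  calc 1 / 4 / ((max (G.degree v) (G.degree u) : ℕ) : ℝ) = π v u / 4 + π u v / 4 := by
        rw [hsymm u v]
        simp only [hπ, if_pos hadj]
        ring
    _ ≤ _ := add_le_add (hEg v u hne) (hEg u v hne.symm)
    _ = P.expect fun x => g v u x + g u v x := (PMF.expect_add _ _ _).symm
    _ ≤ _ := PMF.expect_mono _ fun x hx => ?_
  have h1 := hgle v u hne x hx
  have h2 := hgle u v hne.symm x hx
  rw [Sym2.eq_swap (a := u)] at h2
  -- A link out of `v` puts `v` in `I`, which rules out the opposite orientation, so only one of the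
  -- two terms can be non-zero.
  by_cases hv : (x v).2 = some u
  · have h3 := mem_support_independentFamily hx v
    rw [show x v = ((x v).1, some u) from Prod.ext rfl hv] at h3
    have h4 : ψ (x v) = 0 := by simp [hψ, (mem_support_dsChoice h3).1]
    have : g u v x = 0 := by rw [hg', h4, mul_zero, zero_mul]
    rw [this, add_zero]
    convert h1
    exact Iff.rfl
  · have h4 : χ u (x v) = 0 := by simp [hχ, hv]
    have : g v u x = 0 := by rw [hg', h4, zero_mul, zero_mul]
    rw [this, zero_add]
    convert h2
    exact Iff.rfl

end DS

end Auxiliary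

theorem mainTheorem3 :
    (∀ θ F a : ℝ, 0 < θ → 0 < F → 0 < a → ∃ C : ℝ, 0 < C ∧
      ∀ (V : Type*) [Fintype V] [Nonempty V] (p q : ℝ),
        0 < p → p ≤ 1 → 0 ≤ q → q < 1 →
        θ / Fintype.card V ≤ max p (1 - q) →
        ∀ A : MatchingRule V, A.IsRandomMatching → A.IsFair F →
        ∀ (G₀ : SimpleGraph V) (Γ₀ : V → ℕ),
          1 - (Fintype.card V : ℝ) ^ (-a) ≤
            (executionLaw A p q G₀ Γ₀).real
              {ω | (balancingTime ω : ENNReal) ≤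
                ENNReal.ofReal (C * (max p (1 - q) / min p (1 - q)) *
                  Real.log (discrepancy Γ₀ * Fintype.card V))}) ∧
    (∀ (V : Type*) [Fintype V],
      (MatchingRule.ofStatic (lrMatching (V := V))).IsRandomMatching ∧
      (MatchingRule.ofStatic (lrMatching (V := V))).IsFair (1 / 8)) ∧
    (∀ (V : Type*) [Fintype V],
      (MatchingRule.ofStatic (dsMatching (V := V))).IsRandomMatching ∧
      (MatchingRule.ofStatic (dsMatching (V := V))).IsFair (1 / 4)) := by
  refine ⟨fun θ F a hθ hF ha => ⟨32 * (2 + a) / (F / (1 / θ + 2)) + 4, by positivity, ?_⟩,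
    fun V _ => ⟨isRandomMatching_lrMatching, isFair_lrMatching⟩,
    fun V _ => ⟨isRandomMatching_dsMatching, isFair_dsMatching⟩⟩
  intro V _ _ p q hp hp1 hq hq1 hpq A hA hfair G₀ Γ₀
  exact le_executionLaw_balancingTime hθ hF ha hp hp1 hq hq1 hpq hA hfair G₀ Γ₀
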